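/- For a bounded nonempty open set $\Omega\subset\mathbb{C}$ let $A^2(\Omega)$ be the Bergman space of holomorphic functions on $\Omega$ that are square integrable with respect to Lebesgue measure, $P_\Omega:L^2(\Omega)\to A^2(\Omega)$ the orthogonal projection, $K^\Omega$ the Bergman kernel and $k_z^\Omega=K^\Omega(\cdot,z)/\sqrt{K^\Omega(z,z)}$. If $\phi$ is a function on $\Omega$ such that the Toeplitz operator $T_\phi f=P_\Omega(\phi f)$ is defined and bounded on $A^2(\Omega)$, its Berezin transform is $B_\Omega\phi(z)=\langle T_\phi k_z^\Omega,k_z^\Omega\rangle$, $z\in\Omega$. Let $A_r=\{z\in\mathbb{C}:r<|z|<1\}$ for $0<r<1$, let $\mathbb{D}^*=\{z\in\mathbb{C}:0<|z|<1\}$ and $\phi(z)=\log|z|$. Then $T_\phi$ is defined and bounded on $A^2(A_r)$ for every $0<r<1$ and on $A^2(\mathbb{D}^*)$, and $$B_{A_r}\phi(z)\to\frac{|z|^2}{4}-\frac{1}{4|z|^2}$$ uniformly on compact subsets of $\mathbb{D}^*$ as $r\to0^+$. On the other hand, for every $z\in\mathbb{D}^*$, $$B_{\mathbb{D}^*}\phi(z)=\frac{|z|^2-1}{2}\neq\frac{|z|^2}{4}-\frac{1}{4|z|^2}.$$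 -/

import Mathlib

open MeasureTheory Filter Topology

noncomputable section

namespace Bergman

/-! Square-integrable holomorphic functions on an open subset of the plane. -/

/-- The Bergman space `A²(Ω)`: the classes in `L²(Ω)` (Lebesgue measure) that have a
holomorphic representative. -/
def space (Ω : TopologicalSpace.Opens ℂ) :
    Submodule ℂ (Lp ℂ 2 ((volume : Measure ℂ).restrict Ω)) where
  carrier := {f | ∃ g : ℂ → ℂ, DifferentiableOn ℂ g Ω ∧ f =ᵐ[(volume : Measure ℂ).restrict Ω] g}
  add_mem' := by
    rintro f₁ f₂ ⟨g₁, hg₁, h₁⟩ ⟨g₂, hg₂, h₂⟩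
    exact ⟨g₁ + g₂, hg₁.add hg₂, (Lp.coeFn_add f₁ f₂).trans (h₁.add h₂)⟩
  zero_mem' := ⟨0, differentiableOn_const 0, Lp.coeFn_zero _ _ _⟩
  smul_mem' := by
    rintro c f ⟨g, hg, h⟩
    exact ⟨c • g, hg.const_smul c, (Lp.coeFn_smul c f).trans (h.const_smul c)⟩

/-- The holomorphic representative of an element of the Bergman space. -/
def rep {Ω : TopologicalSpace.Opens ℂ} (f : space Ω) : ℂ → ℂ := f.2.choose

lemma differentiableOn_rep {Ω : TopologicalSpace.Opens ℂ} (f : space Ω) :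
    DifferentiableOn ℂ (rep f) Ω := f.2.choose_spec.1

lemma coeFn_ae_eq_rep {Ω : TopologicalSpace.Opens ℂ} (f : space Ω) :
    (f : Lp ℂ 2 ((volume : Measure ℂ).restrict Ω)) =ᵐ[(volume : Measure ℂ).restrict Ω] rep f :=
  f.2.choose_spec.2

lemma rep_eqOn {Ω : TopologicalSpace.Opens ℂ} (f : space Ω) {g : ℂ → ℂ}
    (hg : DifferentiableOn ℂ g Ω)
    (h : (f : Lp ℂ 2 ((volume : Measure ℂ).restrict Ω)) =ᵐ[(volume : Measure ℂ).restrict Ω] g) :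
    Set.EqOn (rep f) g Ω :=
  Measure.eqOn_open_of_ae_eq ((coeFn_ae_eq_rep f).symm.trans h) Ω.isOpen
    (differentiableOn_rep f).continuousOn hg.continuousOn

lemma rep_add {Ω : TopologicalSpace.Opens ℂ} (f g : space Ω) :
    Set.EqOn (rep (f + g)) (rep f + rep g) Ω :=
  rep_eqOn _ ((differentiableOn_rep f).add (differentiableOn_rep g))
    ((Lp.coeFn_add _ _).trans ((coeFn_ae_eq_rep f).add (coeFn_ae_eq_rep g)))

lemma rep_smul {Ω : TopologicalSpace.Opens ℂ} (c : ℂ) (f : space Ω) :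
    Set.EqOn (rep (c • f)) (c • rep f) Ω :=
  rep_eqOn _ ((differentiableOn_rep f).const_smul c)
    ((Lp.coeFn_smul _ _).trans ((coeFn_ae_eq_rep f).const_smul c))

/-- The mean value property over discs. -/
lemma integral_ball {g : ℂ → ℂ} {c : ℂ} {R : ℝ}
    (hg : DifferentiableOn ℂ g (Metric.closedBall c R)) :
    ∫ w in Metric.ball c R, g w = (volume.real (Metric.ball (0 : ℂ) R) : ℂ) * g c := by
  have hgc : ContinuousOn g (Metric.closedBall c R) := hg.continuousOn
  have hrot : ∀ θ : ℝ, ∫ w in Metric.ball (0 : ℂ) R, g (c + circleMap 0 1 θ * w)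
      = ∫ w in Metric.ball c R, g w := by
    intro θ
    have e : MeasurePreserving (fun w : ℂ => c + rotation (Circle.exp θ) w) volume volume :=
      (measurePreserving_add_left volume c).comp (rotation (Circle.exp θ)).measurePreserving
    have emb : MeasurableEmbedding (fun w : ℂ => c + rotation (Circle.exp θ) w) :=
      (measurableEmbedding_addLeft c).comp
        (rotation (Circle.exp θ)).toHomeomorph.measurableEmbedding
    have hpre : (fun w : ℂ => c + rotation (Circle.exp θ) w) ⁻¹' Metric.ball c R
        = Metric.ball (0 : ℂ) R := by
      ext w; simp
    rw [← e.setIntegral_preimage_emb emb g (Metric.ball c R), hpre]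
    simp [circleMap]
  have hmean : ∀ w ∈ Metric.ball (0 : ℂ) R,
      ∫ θ in (0 : ℝ)..2 * Real.pi, g (c + circleMap 0 1 θ * w) = 2 * Real.pi * g c := by
    intro w hw
    have hmaps : Set.MapsTo (fun u : ℂ => c + u * w) (Metric.closedBall 0 1)
        (Metric.closedBall c R) := by
      intro u hu
      simp only [mem_closedBall_zero_iff, mem_ball_zero_iff] at hu hw
      simp only [Metric.mem_closedBall, dist_self_add_left, norm_mul]
      nlinarith [norm_nonneg u, norm_nonneg w]
    have hd : DifferentiableOn ℂ (fun u : ℂ => g (c + u * w)) (Metric.closedBall 0 1) :=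
      hg.comp (by fun_prop) hmaps
    have h1 : DiffContOnCl ℂ (fun u : ℂ => g (c + u * w)) (Metric.ball 0 |1|) := by
      apply DifferentiableOn.diffContOnCl
      rw [abs_one, closure_ball _ one_ne_zero]
      exact hd
    have h2 := h1.circleAverage
    simp only [Real.circleAverage_def, zero_mul, add_zero, Complex.real_smul] at h2
    rw [← h2]
    have hpi : (2 * Real.pi : ℂ) ≠ 0 := by exact_mod_cast Real.two_pi_pos.ne'
    push_cast
    rw [mul_inv_cancel_left₀ hpi]
  have hint : Integrable (Function.uncurry fun (θ : ℝ) (w : ℂ) => g (c + circleMap 0 1 θ * w))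
      ((volume.restrict (Set.uIoc 0 (2 * Real.pi))).prod
        (volume.restrict (Metric.ball (0 : ℂ) R))) := by
    rw [Measure.prod_restrict]
    have hc : ContinuousOn (Function.uncurry fun (θ : ℝ) (w : ℂ) => g (c + circleMap 0 1 θ * w))
        (Set.uIcc 0 (2 * Real.pi) ×ˢ Metric.closedBall (0 : ℂ) R) := by
      apply hgc.comp
      · have : Continuous fun p : ℝ × ℂ => c + circleMap 0 1 p.1 * p.2 := by fun_prop
        exact this.continuousOn
      · rintro ⟨θ, w⟩ ⟨-, hw⟩
        simpa using hw
    exact (hc.integrableOn_compact (isCompact_uIcc.prod (isCompact_closedBall _ _))).mono_set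
      (Set.prod_mono Set.uIoc_subset_uIcc Metric.ball_subset_closedBall)
  have hswap := intervalIntegral_integral_swap hint
  rw [setIntegral_congr_fun Metric.isOpen_ball.measurableSet hmean] at hswap
  simp only [hrot, intervalIntegral.integral_const, integral_const, measureReal_restrict_apply_univ,
    sub_zero, Complex.real_smul] at hswap
  have hpi : ((2 * Real.pi : ℝ) : ℂ) ≠ 0 := by exact_mod_cast Real.two_pi_pos.ne'
  apply mul_left_cancel₀ hpi
  rw [hswap]
  push_cast
  ring

/-- Point evaluations are bounded on the Bergman space. -/
lemma norm_rep_le {Ω : TopologicalSpace.Opens ℂ} (f : space Ω) {c : ℂ} {R : ℝ} (hR : 0 < R)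
    (h : Metric.closedBall c R ⊆ Ω) :
    ‖rep f c‖ ≤ (Real.sqrt (volume.real (Metric.ball (0 : ℂ) R)))⁻¹ * ‖f‖ := by
  have hsub : Metric.ball c R ⊆ Ω := Metric.ball_subset_closedBall.trans h
  have hB : MeasurableSet (Metric.ball c R) := Metric.isOpen_ball.measurableSet
  have hμ : ((volume : Measure ℂ).restrict Ω).restrict (Metric.ball c R)
      = volume.restrict (Metric.ball c R) := by
    rw [Measure.restrict_restrict hB, Set.inter_eq_left.mpr hsub]
  have hval : ((volume : Measure ℂ).restrict Ω) (Metric.ball c R) = volume (Metric.ball c R) := by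
    rw [Measure.restrict_apply hB, Set.inter_eq_left.mpr hsub]
  have hfin : ((volume : Measure ℂ).restrict Ω) (Metric.ball c R) ≠ ⊤ := by
    rw [hval]; exact measure_ball_lt_top.ne
  have hval' : ((volume : Measure ℂ).restrict Ω).real (Metric.ball c R)
      = volume.real (Metric.ball c R) := by
    rw [measureReal_def, hval, ← measureReal_def]
  have hvol : volume.real (Metric.ball c R) = volume.real (Metric.ball (0 : ℂ) R) := by
    simp [Measure.real, Complex.volume_ball]
  have hpos : 0 < volume.real (Metric.ball (0 : ℂ) R) :=
    ENNReal.toReal_pos (Metric.measure_ball_pos volume _ hR).ne' measure_ball_lt_top.ne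
  have h1 := L2.inner_indicatorConstLp_one (𝕜 := ℂ) hB hfin (f : Lp ℂ 2 _)
  have h2 : ∫ x in Metric.ball c R, (f : Lp ℂ 2 ((volume : Measure ℂ).restrict Ω)) x
      ∂((volume : Measure ℂ).restrict Ω) = ∫ x in Metric.ball c R, rep f x := by
    rw [hμ]
    apply integral_congr_ae
    rw [← hμ]
    exact ae_restrict_of_ae (coeFn_ae_eq_rep f)
  rw [h2, integral_ball ((differentiableOn_rep f).mono h)] at h1
  have h3 := norm_inner_le_norm (𝕜 := ℂ)
    (indicatorConstLp 2 hB hfin (1 : ℂ)) (f : Lp ℂ 2 ((volume : Measure ℂ).restrict Ω))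
  rw [h1, norm_indicatorConstLp (by norm_num) (by norm_num), norm_mul, Complex.norm_real,
    Real.norm_of_nonneg hpos.le, hval', hvol] at h3
  simp only [norm_one, one_mul, ENNReal.toReal_ofNat, ← Real.sqrt_eq_rpow] at h3
  have hs := Real.sqrt_pos.mpr hpos
  rw [← div_eq_inv_mul, le_div_iff₀ hs]
  have hss := Real.mul_self_sqrt hpos.le
  refine le_of_mul_le_mul_left ?_ hs
  calc _ = (Real.sqrt (volume.real (Metric.ball (0 : ℂ) R))
        * Real.sqrt (volume.real (Metric.ball (0 : ℂ) R))) * ‖rep f c‖ := by ring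
    _ ≤ _ := by rw [hss]; exact h3

/-- The Bergman space is closed in `L²`. -/
lemma isClosed_space (Ω : TopologicalSpace.Opens ℂ) :
    IsClosed (space Ω : Set (Lp ℂ 2 ((volume : Measure ℂ).restrict Ω))) := by
  apply IsSeqClosed.isClosed
  intro F f hF hlim
  let G : ℕ → space Ω := fun n => ⟨F n, hF n⟩
  have hG : CauchySeq G := by
    have : CauchySeq F := hlim.cauchySeq
    rw [Metric.cauchySeq_iff] at this ⊢
    exact this
  have hsubrep : ∀ m n, Set.EqOn (rep (G m - G n)) (rep (G m) - rep (G n)) Ω := fun m n =>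
    rep_eqOn _ ((differentiableOn_rep _).sub (differentiableOn_rep _))
      ((Lp.coeFn_sub _ _).trans ((coeFn_ae_eq_rep _).sub (coeFn_ae_eq_rep _)))
  have key : ∀ c ∈ Ω, ∃ R > 0, Metric.ball c R ⊆ Ω ∧
      UniformCauchySeqOn (fun n => rep (G n)) atTop (Metric.ball c R) := by
    intro c hc
    obtain ⟨ε, hε, hball⟩ := Metric.isOpen_iff.mp Ω.isOpen c hc
    have hsub : ∀ w ∈ Metric.ball c (ε / 3), Metric.closedBall w (ε / 3) ⊆ (Ω : Set ℂ) := by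
      intro w hw u hu
      apply hball
      rw [Metric.mem_ball] at hw ⊢
      rw [Metric.mem_closedBall] at hu
      linarith [dist_triangle u w c]
    have hsub' : Metric.ball c (ε / 3) ⊆ (Ω : Set ℂ) := fun w hw =>
      hsub w hw (Metric.mem_closedBall_self (by positivity))
    refine ⟨ε / 3, by positivity, hsub', ?_⟩
    set C := (Real.sqrt (volume.real (Metric.ball (0 : ℂ) (ε / 3))))⁻¹ with hC
    have hC0 : 0 ≤ C := by positivity
    rw [Metric.uniformCauchySeqOn_iff]
    intro δ hδ
    rw [Metric.cauchySeq_iff] at hG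
    obtain ⟨N, hN⟩ := hG (δ / (C + 1)) (by positivity)
    refine ⟨N, fun m hm n hn w hw => ?_⟩
    have h1 := norm_rep_le (G m - G n) (c := w) (R := ε / 3) (by positivity) (hsub w hw)
    rw [hsubrep m n (hsub' hw), ← dist_eq_norm] at h1
    have h2 := hN m hm n hn
    rw [lt_div_iff₀ (by positivity)] at h2
    rw [dist_eq_norm]
    change ‖rep (G m) w - rep (G n) w‖ ≤ C * _ at h1
    nlinarith [dist_nonneg (x := G m) (y := G n)]
  have hpt : ∀ c : ℂ, ∃ l : ℂ, c ∈ Ω → Tendsto (fun n => rep (G n) c) atTop (𝓝 l) := by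
    intro c
    by_cases hc : c ∈ Ω
    · obtain ⟨R, hR, -, hu⟩ := key c hc
      obtain ⟨l, hl⟩ := cauchySeq_tendsto_of_complete (hu.cauchySeq (Metric.mem_ball_self hR))
      exact ⟨l, fun _ => hl⟩
    · exact ⟨0, fun h => absurd h hc⟩
  choose g hg using hpt
  have hloc : TendstoLocallyUniformlyOn (fun n => rep (G n)) g atTop (Ω : Set ℂ) := by
    intro u hu x hx
    obtain ⟨R, hR, hsub, hcau⟩ := key x hx
    exact ⟨Metric.ball x R, mem_nhdsWithin_of_mem_nhds (Metric.ball_mem_nhds x hR),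
      hcau.tendstoUniformlyOn_of_tendsto (fun y hy => hg y (hsub hy)) u hu⟩
  have hdiff : DifferentiableOn ℂ g Ω :=
    hloc.differentiableOn (Eventually.of_forall fun n => differentiableOn_rep (G n)) Ω.isOpen
  refine ⟨g, hdiff, ?_⟩
  obtain ⟨ns, hns, hae⟩ := (tendstoInMeasure_of_tendsto_Lp hlim).exists_seq_tendsto_ae
  have hall : ∀ᵐ x ∂((volume : Measure ℂ).restrict Ω), ∀ n, F n x = rep (G n) x :=
    ae_all_iff.mpr fun n => coeFn_ae_eq_rep (G n)
  filter_upwards [hae, hall, ae_restrict_mem Ω.isOpen.measurableSet] with x h1 h2 h3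
  simp only [h2] at h1
  exact tendsto_nhds_unique h1 ((hg x h3).comp hns.tendsto_atTop)

instance (Ω : TopologicalSpace.Opens ℂ) : CompleteSpace (space Ω) :=
  (isClosed_space Ω).completeSpace_coe

/-- Evaluation at a point of `Ω`, as a bounded functional on the Bergman space. -/
def evalCLM {Ω : TopologicalSpace.Opens ℂ} (z : Ω) : space Ω →L[ℂ] ℂ :=
  LinearMap.mkContinuousOfExistsBound
    { toFun := fun f => rep f z
      map_add' := fun f g => rep_add f g z.2
      map_smul' := fun c f => rep_smul c f z.2 }
    (by
      obtain ⟨ε, hε, hball⟩ := Metric.isOpen_iff.mp Ω.isOpen z z.2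
      exact ⟨_, fun f => norm_rep_le f (half_pos hε)
        ((Metric.closedBall_subset_ball (half_lt_self hε)).trans hball)⟩)

/-- The Bergman space as a reproducing kernel Hilbert space; `f z` is the value at `z ∈ Ω` of the
holomorphic representative of `f`. -/
instance (Ω : TopologicalSpace.Opens ℂ) : RKHS ℂ (space Ω) Ω ℂ where
  coeCLM := .pi evalCLM
  coeCLM_injective := by
    intro f g h
    have hfg : ∀ z ∈ Ω, rep f z = rep g z := fun z hz => congrFun h ⟨z, hz⟩
    apply Subtype.ext
    apply Lp.ext
    filter_upwards [coeFn_ae_eq_rep f, coeFn_ae_eq_rep g,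
      ae_restrict_mem Ω.isOpen.measurableSet] with z h1 h2 h3
    rw [h1, h2, hfg z h3]

lemma apply_eq_rep {Ω : TopologicalSpace.Opens ℂ} (f : space Ω) (z : Ω) : f z = rep f z := rfl

/-- The Bergman kernel `K^Ω(z, w)`. -/
def kernel (Ω : TopologicalSpace.Opens ℂ) (z w : Ω) : ℂ := RKHS.kernel (space Ω) z w 1

/-- The function `K^Ω(·, z)`, an element of the Bergman space. -/
def kernelFun {Ω : TopologicalSpace.Opens ℂ} (z : Ω) : space Ω := RKHS.kerFun (space Ω) z 1

lemma kernelFun_apply {Ω : TopologicalSpace.Opens ℂ} (z w : Ω) :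
    kernelFun z w = kernel Ω w z :=
  RKHS.kerFun_apply (space Ω) z 1 w

/-- The reproducing property. -/
lemma inner_kernelFun {Ω : TopologicalSpace.Opens ℂ} (z : Ω) (f : space Ω) :
    inner ℂ (kernelFun z) f = f z := by
  simp [kernelFun]

/-- The normalized Bergman kernel `k_z = K(·, z) / √K(z, z)`. -/
def normalizedKernel {Ω : TopologicalSpace.Opens ℂ} (z : Ω) : space Ω :=
  ((Real.sqrt (kernel Ω z z).re : ℂ))⁻¹ • kernelFun z

/-- The Berezin transform `⟨T k_z, k_z⟩` of a bounded operator on the Bergman space (Mathlib's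
inner product is linear in its second argument). -/
def berezinOp {Ω : TopologicalSpace.Opens ℂ} (T : space Ω →L[ℂ] space Ω) (z : Ω) : ℂ :=
  inner ℂ (normalizedKernel z) (T (normalizedKernel z))

/-- The Bergman projection: the orthogonal projection of `L²(Ω)` onto the Bergman space. -/
def projection (Ω : TopologicalSpace.Opens ℂ) :
    Lp ℂ 2 ((volume : Measure ℂ).restrict Ω) →L[ℂ] space Ω :=
  (space Ω).orthogonalProjectionOnto

/-- `T` is the Toeplitz operator `f ↦ P(φ f)`, defined on the whole Bergman space. -/
def IsToeplitz {Ω : TopologicalSpace.Opens ℂ} (φ : ℂ → ℂ) (T : space Ω →L[ℂ] space Ω) : Prop :=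
  ∀ f : space Ω, ∃ h : MemLp (fun w => φ w * rep f w) 2 ((volume : Measure ℂ).restrict Ω),
    T f = projection Ω h.toLp

lemma IsToeplitz.unique {Ω : TopologicalSpace.Opens ℂ} {φ : ℂ → ℂ} {S T : space Ω →L[ℂ] space Ω}
    (hS : IsToeplitz φ S) (hT : IsToeplitz φ T) : S = T := by
  ext1 f
  obtain ⟨_, h1⟩ := hS f
  obtain ⟨_, h2⟩ := hT f
  rw [h1, h2]

/-- `φ` is the symbol of a bounded Toeplitz operator on the Bergman space of `Ω`. -/
def IsBoundedSymbol (Ω : TopologicalSpace.Opens ℂ) (φ : ℂ → ℂ) : Prop :=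
  ∃ T : space Ω →L[ℂ] space Ω, IsToeplitz φ T

open Classical in
/-- The bounded Toeplitz operator `T_φ`; it is `0` by convention if `φ` is not the symbol of
a bounded Toeplitz operator. -/
def toeplitz (Ω : TopologicalSpace.Opens ℂ) (φ : ℂ → ℂ) : space Ω →L[ℂ] space Ω :=
  if h : IsBoundedSymbol Ω φ then h.choose else 0

lemma IsToeplitz.toeplitz_eq {Ω : TopologicalSpace.Opens ℂ} {φ : ℂ → ℂ}
    {T : space Ω →L[ℂ] space Ω} (hT : IsToeplitz φ T) : toeplitz Ω φ = T := by
  have h : IsBoundedSymbol Ω φ := ⟨T, hT⟩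
  rw [toeplitz, dif_pos h]
  exact h.choose_spec.unique hT

open Classical in
/-- The Berezin transform `B_Ω φ = B_Ω T_φ` of a symbol, extended by zero outside `Ω`. -/
def berezin (Ω : TopologicalSpace.Opens ℂ) (φ : ℂ → ℂ) (z : ℂ) : ℂ :=
  if h : z ∈ Ω then berezinOp (toeplitz Ω φ) ⟨z, h⟩ else 0

/-- The annulus `r < |z| < 1`. -/
def annulus (r : ℝ) : TopologicalSpace.Opens ℂ :=
  ⟨{z | r < ‖z‖ ∧ ‖z‖ < 1}, (isOpen_lt continuous_const continuous_norm).inter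
    (isOpen_lt continuous_norm continuous_const)⟩

/-- The punctured unit disc. -/
def puncturedDisc : TopologicalSpace.Opens ℂ :=
  ⟨{z | z ≠ 0 ∧ ‖z‖ < 1}, isOpen_ne.inter (isOpen_lt continuous_norm continuous_const)⟩

/-- The symbol `log |z|`. -/
def logNorm (z : ℂ) : ℂ := (Real.log ‖z‖ : ℂ)

end Bergman

end

noncomputable section

namespace Bergman

/-! Polar coordinates on annuli. -/

/-! Since `log |z|` is radial, the Toeplitz operator is diagonal in the orthogonal family of
monomials `z ^ n`: the eigenvalue at `n` is `λ n = logMoment r n / moment r n`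
(`inner_monomial_toeplitz`). Parseval then writes the Berezin transform as the average of the `λ n`
with weights `|z| ^ (2 n) / (2 π moment r n)`, the terms of the kernel on the diagonal
(`berezin_eq`). The punctured disc is treated as `annulus 0`, so one computation serves both
domains. Only the index set differs: all integers for `r > 0`, but only `n ≥ 0` for `r = 0`, because
a square integrable function has no negative Laurent coefficients at the puncture
(`laurent_eq_zero_of_neg`).

On the punctured disc `λ n = -1 / (2 (n + 1))`, and with `s = |z|` the two series sum to `-1 / (2 π
(1 - s²))` and `1 / (π (1 - s²)²)`, whose quotient is `(s² - 1) / 2`.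

As `r → 0`, the terms with `n ≥ 0` tend to those of the disc and the terms with `n ≤ -2` vanish. The
index `-1` makes the difference: its weight `s⁻² / (2 π log (1 / r))` tends to zero, but its
eigenvalue is `log r / 2`, so its contribution to the numerator is `-1 / (4 π s²)` for every small
`r` (`logKernelTerm_neg_one`). It survives in the limit and shifts the quotient by `-(1 - s²)² / (4
s²)`. Dominated convergence, jointly in `r` and `s` (`tendsto_tsum_int`), gives the limit with local
uniformity. -/

lemma mem_annulus {r : ℝ} {z : ℂ} : z ∈ annulus r ↔ r < ‖z‖ ∧ ‖z‖ < 1 := Iff.rfl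

lemma annulus_zero : annulus 0 = puncturedDisc := by
  ext z
  change (0 < ‖z‖ ∧ ‖z‖ < 1) ↔ (z ≠ 0 ∧ ‖z‖ < 1)
  rw [norm_pos_iff]

lemma circleMap_mem_annulus {r t : ℝ} (hr : 0 ≤ r) (ht : t ∈ Set.Ioo r 1) (θ : ℝ) :
    circleMap 0 t θ ∈ annulus r := by
  rw [mem_annulus, norm_circleMap_zero, abs_of_pos (hr.trans_lt ht.1)]
  exact ht

lemma polarCoord_symm_eq_circleMap (p : ℝ × ℝ) :
    Complex.polarCoord.symm p = circleMap 0 p.1 p.2 := by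
  simp [circleMap, Complex.exp_mul_I]

/-- Supplies the integrability that Fubini requires after the change to polar coordinates. -/
lemma integrableOn_polarCoord {g : ℂ → ℂ} (hg : Integrable g) :
    IntegrableOn (fun p : ℝ × ℝ => p.1 • g (circleMap 0 p.1 p.2)) polarCoord.target := by
  have h1 : Integrable (g ∘ Complex.measurableEquivRealProd.symm) :=
    (Complex.volume_preserving_equiv_real_prod.symm).integrable_comp_emb
      Complex.measurableEquivRealProd.symm.measurableEmbedding |>.mpr hg
  have h2 := (integrableOn_image_iff_integrableOn_abs_det_fderiv_smul volume
    polarCoord.open_target.measurableSet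
    (fun p _ => (hasFDerivAt_polarCoord_symm p).hasFDerivWithinAt)
    polarCoord.symm.injOn (g ∘ Complex.measurableEquivRealProd.symm)).mp h1.integrableOn
  refine h2.congr_fun (fun p hp => ?_) polarCoord.open_target.measurableSet
  simp only [det_fderivPolarCoordSymm, Function.comp_apply]
  rw [abs_of_pos hp.1, Complex.measurableEquivRealProd_symm_polarCoord_symm_apply, polarCoord_symm_eq_circleMap]

lemma setIntegral_annulus {r : ℝ} (hr : 0 ≤ r) {g : ℂ → ℂ} (hg : IntegrableOn g (annulus r)) :
    ∫ w in annulus r, g w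
      = ∫ t in Set.Ioo r 1, ∫ θ in Set.Ioo (-Real.pi) Real.pi, (t : ℂ) * g (circleMap 0 t θ) := by
  have hm : MeasurableSet (annulus r : Set ℂ) := (annulus r).isOpen.measurableSet
  have key : ∀ p ∈ polarCoord.target,
      p.1 • (annulus r : Set ℂ).indicator g (circleMap 0 p.1 p.2)
        = (Set.Ioo r 1 ×ˢ Set.univ).indicator
          (fun p : ℝ × ℝ => (p.1 : ℂ) * g (circleMap 0 p.1 p.2)) p := by
    rintro ⟨t, θ⟩ ⟨ht, -⟩
    have ht : 0 < t := ht
    by_cases h : t ∈ Set.Ioo r 1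
    · rw [Set.indicator_of_mem (circleMap_mem_annulus hr h θ), Set.indicator_of_mem (by simpa using h),
        Complex.real_smul]
    · rw [Set.indicator_of_notMem, Set.indicator_of_notMem (by simpa using h), smul_zero]
      intro h'
      rw [SetLike.mem_coe, mem_annulus, norm_circleMap_zero, abs_of_pos ht] at h'
      exact h h'
  have hs : polarCoord.target ∩ Set.Ioo r 1 ×ˢ Set.univ
      = Set.Ioo r 1 ×ˢ Set.Ioo (-Real.pi) Real.pi := by
    ext ⟨t, θ⟩
    simp only [polarCoord_target, Set.mem_inter_iff, Set.mem_prod, Set.mem_Ioi, Set.mem_Ioo,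
      Set.mem_univ, and_true]
    constructor
    · rintro ⟨⟨_, h⟩, h'⟩; exact ⟨h', h⟩
    · rintro ⟨h', h⟩; exact ⟨⟨hr.trans_lt h'.1, h⟩, h'⟩
  have hmp : MeasurableSet (Set.Ioo r 1 ×ˢ (Set.univ : Set ℝ)) :=
    measurableSet_Ioo.prod MeasurableSet.univ
  have hint := integrableOn_polarCoord (hg.integrable_indicator hm)
  rw [integrableOn_congr_fun key polarCoord.open_target.measurableSet, IntegrableOn,
    integrable_indicator_iff hmp, IntegrableOn, Measure.restrict_restrict hmp, Set.inter_comm, hs] at hint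
  rw [← integral_indicator hm, ← Complex.integral_comp_polarCoord_symm]
  simp only [polarCoord_symm_eq_circleMap]
  rw [setIntegral_congr_fun polarCoord.open_target.measurableSet key, setIntegral_indicator hmp, hs]
  exact setIntegral_prod _ hint

/-- The `n`-th Laurent coefficient, times `2π`, computed on the circle of radius `t`. -/
def laurent (n : ℤ) (f : ℂ → ℂ) (t : ℝ) : ℂ :=
  ∫ θ in (-Real.pi)..Real.pi, circleMap 0 t θ ^ (-n) * f (circleMap 0 t θ)

/-- On the circle `dw = i w dθ`, so the factor `w⁻¹` cancels. This is the integrand for which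
Cauchy's theorem on annuli is available. -/
lemma laurent_eq_circleIntegral (n : ℤ) (f : ℂ → ℂ) {t : ℝ} (ht : t ≠ 0) :
    ∮ w in C(0, t), (w - 0)⁻¹ • (w ^ (-n) * f w) = Complex.I * laurent n f t := by
  have hper : Function.Periodic
      (fun θ => circleMap 0 t θ ^ (-n) * f (circleMap 0 t θ)) (2 * Real.pi) := by
    intro θ
    simp only [periodic_circleMap 0 t θ]
  have h := hper.intervalIntegral_add_eq (-Real.pi) 0
  rw [show -Real.pi + 2 * Real.pi = Real.pi by ring, zero_add] at h
  rw [laurent, h, circleIntegral, ← intervalIntegral.integral_const_mul]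
  congr 1
  ext θ
  have hc : circleMap 0 t θ ≠ 0 := by
    rw [← norm_ne_zero_iff, norm_circleMap_zero]; simpa using ht
  simp only [deriv_circleMap, smul_eq_mul, sub_zero]
  field_simp

lemma laurent_eq {r : ℝ} (hr : 0 ≤ r) {f : ℂ → ℂ} (hf : DifferentiableOn ℂ f (annulus r)) (n : ℤ)
    {s t : ℝ} (hs : s ∈ Set.Ioo r 1) (ht : t ∈ Set.Ioo r 1) : laurent n f s = laurent n f t := by
  wlog hst : s ≤ t generalizing s t
  · exact (this ht hs (le_of_not_ge hst)).symm
  have hs0 : 0 < s := hr.trans_lt hs.1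
  have hd : DifferentiableOn ℂ (fun w => w ^ (-n) * f w) (annulus r) := by
    refine DifferentiableOn.mul (fun w hw => ?_) hf
    refine (differentiableAt_zpow.mpr (Or.inl ?_)).differentiableWithinAt
    exact norm_pos_iff.mp (hr.trans_lt hw.1)
  have h := Complex.circleIntegral_sub_center_inv_smul_eq_of_differentiable_on_annulus_off_countable
    (c := 0) hs0 hst (f := fun w => w ^ (-n) * f w) Set.countable_empty
    (hd.continuousOn.mono (by
      rintro w ⟨h1, h2⟩
      simp only [mem_closedBall_zero_iff, mem_ball_zero_iff, not_lt] at h1 h2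
      exact ⟨hs.1.trans_le h2, h1.trans_lt ht.2⟩))
    (by
      rintro w ⟨⟨h1, h2⟩, -⟩
      simp only [mem_closedBall_zero_iff, mem_ball_zero_iff, not_le] at h1 h2
      exact hd.differentiableAt ((annulus r).isOpen.mem_nhds ⟨hs.1.trans h2, h1.trans ht.2⟩))
  rw [laurent_eq_circleIntegral n f hs0.ne', laurent_eq_circleIntegral n f (hs0.trans_le hst).ne'] at h
  exact (mul_left_cancel₀ Complex.I_ne_zero h).symm

/-- From `conj w = |w|² / w`: on a circle, pairing with `w ^ n` extracts a Laurent coefficient. -/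
lemma conj_zpow_eq {w : ℂ} (hw : w ≠ 0) (n : ℤ) :
    (starRingEnd ℂ) (w ^ n) = (‖w‖ : ℂ) ^ (2 * n) * w ^ (-n) := by
  have h : (starRingEnd ℂ) w = (‖w‖ : ℂ) ^ (2 : ℤ) * w⁻¹ := by
    have := Complex.mul_conj' w
    rw [eq_mul_inv_iff_mul_eq₀ hw, mul_comm]
    exact_mod_cast this
  rw [map_zpow₀, h, mul_zpow, ← zpow_mul, inv_zpow']

/-- Pairing with a monomial and a radial weight in polar coordinates. -/
lemma integral_radial_mul_conj_zpow {r : ℝ} (hr : 0 ≤ r) {f : ℂ → ℂ}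
    (hf : DifferentiableOn ℂ f (annulus r)) (n : ℤ) (ψ : ℝ → ℝ) {ρ : ℝ} (hρ : ρ ∈ Set.Ioo r 1)
    (hint : IntegrableOn (fun w => (starRingEnd ℂ) (w ^ n) * (ψ ‖w‖ * f w)) (annulus r)) :
    ∫ w in annulus r, (starRingEnd ℂ) (w ^ n) * (ψ ‖w‖ * f w)
      = ((∫ t in r..1, t ^ (2 * n + 1) * ψ t : ℝ) : ℂ) * laurent n f ρ := by
  rw [setIntegral_annulus hr hint, ← intervalIntegral.integral_ofReal,
    intervalIntegral.integral_of_le (hρ.1.trans hρ.2).le, integral_Ioc_eq_integral_Ioo,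
    ← integral_mul_const]
  refine setIntegral_congr_fun measurableSet_Ioo fun t ht => ?_
  have ht0 : 0 < t := hr.trans_lt ht.1
  have hpi : -Real.pi ≤ Real.pi := by linarith [Real.pi_pos]
  -- Cauchy's theorem moves the coefficient from radius `ρ` to the current radius `t`, which
  -- separates the radial integral from the angular one.
  rw [laurent_eq hr hf n hρ ht, laurent, intervalIntegral.integral_of_le hpi,
    integral_Ioc_eq_integral_Ioo, ← integral_const_mul]
  congr 1
  ext θ
  have hc : circleMap 0 t θ ≠ 0 := by
    rw [← norm_ne_zero_iff, norm_circleMap_zero]; simpa using ht0.ne'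
  have htc : (t : ℂ) ≠ 0 := by exact_mod_cast ht0.ne'
  rw [conj_zpow_eq hc, norm_circleMap_zero, abs_of_pos ht0]
  push_cast
  rw [zpow_add₀ htc, zpow_one]
  ring

lemma laurent_zpow (m n : ℤ) {t : ℝ} (ht : 0 < t) :
    laurent n (fun w => w ^ m) t = if m = n then (2 * Real.pi : ℂ) else 0 := by
  have hc : ∀ θ, circleMap 0 t θ ≠ 0 := by
    intro θ
    rw [← norm_ne_zero_iff, norm_circleMap_zero]; simpa using ht.ne'
  have h := laurent_eq_circleIntegral n (fun w => w ^ m) ht.ne'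
  have h2 : ∮ w in C(0, t), (w - 0)⁻¹ • (w ^ (-n) * w ^ m) = ∮ w in C(0, t), (w - 0) ^ (m - n - 1) := by
    refine circleIntegral.integral_congr ht.le fun w hw => ?_
    have hw0 : w ≠ 0 := by
      rw [← norm_ne_zero_iff, mem_sphere_zero_iff_norm.mp hw]; exact ht.ne'
    simp only [sub_zero, smul_eq_mul]
    rw [zpow_sub_one₀ hw0, sub_eq_add_neg, zpow_add₀ hw0]
    ring
  rw [h2] at h
  apply mul_left_cancel₀ Complex.I_ne_zero
  rw [← h]
  split_ifs with hmn
  · simp only [hmn, sub_self, zero_sub, zpow_neg_one]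
    rw [circleIntegral.integral_sub_center_inv _ ht.ne']
    ring
  · rw [mul_zero]
    exact circleIntegral.integral_sub_zpow_of_ne (by omega) _ _ _

/-- A holomorphic function on an annulus whose Laurent coefficients vanish is zero. -/
lemma eq_zero_of_laurent_eq_zero {r : ℝ} (hr : 0 ≤ r) {f : ℂ → ℂ}
    (hf : DifferentiableOn ℂ f (annulus r)) (h : ∀ n, ∀ t ∈ Set.Ioo r 1, laurent n f t = 0)
    {z : ℂ} (hz : z ∈ annulus r) : f z = 0 := by
  have : Fact (0 < 2 * Real.pi) := ⟨Real.two_pi_pos⟩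
  set t := ‖z‖ with ht
  have ht0 : 0 < t := hr.trans_lt hz.1
  have hcirc : ∀ x : AddCircle (2 * Real.pi), (t : ℂ) * (AddCircle.toCircle x : ℂ) ∈ annulus r := by
    intro x
    rw [mem_annulus, norm_mul, Circle.norm_coe, Complex.norm_real, Real.norm_of_nonneg ht0.le, mul_one]
    exact hz
  have hmap : ∀ θ : ℝ, (t : ℂ) * (AddCircle.toCircle (θ : AddCircle (2 * Real.pi)) : ℂ)
      = circleMap 0 t θ := by
    intro θ
    rw [AddCircle.toCircle_apply_mk, div_self Real.two_pi_pos.ne', one_mul, Circle.coe_exp, circleMap,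
      zero_add]
  let F : C(AddCircle (2 * Real.pi), ℂ) :=
    ⟨fun x => f (t * (AddCircle.toCircle x : ℂ)), by
      refine hf.continuousOn.comp_continuous ?_ hcirc
      exact continuous_const.mul (continuous_subtype_val.comp AddCircle.continuous_toCircle)⟩
  -- The Fourier coefficients of `f` on the circle `|w| = t` are multiples of its Laurent
  -- coefficients.
  have hcoeff : ∀ n, fourierCoeff F n = 0 := by
    intro n
    rw [fourierCoeff_eq_intervalIntegral F n (-Real.pi), show -Real.pi + 2 * Real.pi = Real.pi by ring]
    have h2 : ∀ θ : ℝ, fourier (-n) (θ : AddCircle (2 * Real.pi)) • F θ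
        = (t : ℂ) ^ n * (circleMap 0 t θ ^ (-n) * f (circleMap 0 t θ)) := by
      intro θ
      have htc : (t : ℂ) ≠ 0 := by exact_mod_cast ht0.ne'
      have hfour : fourier (-n) (θ : AddCircle (2 * Real.pi))
          = (AddCircle.toCircle (θ : AddCircle (2 * Real.pi)) : ℂ) ^ (-n) := by
        rw [fourier_apply, AddCircle.toCircle_zsmul]
        exact Circle.coe_zpow _ _
      change fourier (-n) (θ : AddCircle (2 * Real.pi)) • f (t * (AddCircle.toCircle _ : ℂ)) = _
      rw [← hmap θ, hfour, mul_zpow, smul_eq_mul, ← mul_assoc, ← mul_assoc, ← zpow_add₀ htc,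
        add_neg_cancel, zpow_zero, one_mul]
    simp only [h2]
    rw [intervalIntegral.integral_const_mul]
    have := h n t hz
    rw [laurent] at this
    rw [this, mul_zero, smul_zero]
  have hsum : Summable (fourierCoeff F) := by
    rw [show fourierCoeff F = fun _ => 0 from funext hcoeff]
    exact summable_zero
  have hF := hasSum_fourier_series_of_summable hsum
  simp only [hcoeff, zero_smul] at hF
  have hF0 : F = 0 := hF.unique hasSum_zero
  have hval := DFunLike.congr_fun hF0 ((Complex.arg z : ℝ) : AddCircle (2 * Real.pi))
  change f (t * (AddCircle.toCircle _ : ℂ)) = 0 at hval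
  rw [hmap, circleMap, zero_add, Complex.norm_mul_exp_arg_mul_I] at hval
  exact hval

/-! Monomials as an orthogonal basis. -/

lemma integrable_conj_mul {Ω : TopologicalSpace.Opens ℂ} {f g : ℂ → ℂ}
    (hf : MemLp f 2 ((volume : Measure ℂ).restrict Ω))
    (hg : MemLp g 2 ((volume : Measure ℂ).restrict Ω)) :
    IntegrableOn (fun w => (starRingEnd ℂ) (f w) * g w) Ω := by
  refine (L2.integrable_inner (𝕜 := ℂ) hf.toLp hg.toLp).congr ?_
  filter_upwards [hf.coeFn_toLp, hg.coeFn_toLp] with w h1 h2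
  rw [h1, h2, RCLike.inner_apply, mul_comm]

lemma inner_toLp {Ω : TopologicalSpace.Opens ℂ} {f g : ℂ → ℂ}
    (hf : MemLp f 2 ((volume : Measure ℂ).restrict Ω))
    (hg : MemLp g 2 ((volume : Measure ℂ).restrict Ω)) :
    inner ℂ hf.toLp hg.toLp = ∫ w in Ω, (starRingEnd ℂ) (f w) * g w := by
  rw [L2.inner_def]
  refine integral_congr_ae ?_
  filter_upwards [hf.coeFn_toLp, hg.coeFn_toLp] with w h1 h2
  rw [h1, h2, RCLike.inner_apply, mul_comm]

lemma space_inner_smul_left {Ω : TopologicalSpace.Opens ℂ} (c : ℂ) (f g : space Ω) :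
    inner ℂ (c • f) g = (starRingEnd ℂ) c * inner ℂ f g := inner_smul_left f g c

lemma space_inner_smul_right {Ω : TopologicalSpace.Opens ℂ} (c : ℂ) (f g : space Ω) :
    inner ℂ f (c • g) = c * inner ℂ f g := inner_smul_right f g c

lemma space_inner_self {Ω : TopologicalSpace.Opens ℂ} (f : space Ω) :
    inner ℂ f f = ((‖f‖ ^ 2 : ℝ) : ℂ) := by
  have h : inner ℂ f f = (‖f‖ : ℂ) ^ 2 := inner_self_eq_norm_sq_to_K f
  rw [h, Complex.ofReal_pow]

lemma memLp_rep {Ω : TopologicalSpace.Opens ℂ} (f : space Ω) :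
    MemLp (rep f) 2 ((volume : Measure ℂ).restrict Ω) :=
  (memLp_congr_ae (coeFn_ae_eq_rep f)).mp (Lp.memLp _)

lemma toLp_rep {Ω : TopologicalSpace.Opens ℂ} (f : space Ω) : (memLp_rep f).toLp = f.1 :=
  Lp.ext ((memLp_rep f).coeFn_toLp.trans (coeFn_ae_eq_rep f).symm)

/-- The moments `∫ t ^ (2 n + 1)` over `(r, 1)`. -/
def moment (r : ℝ) (n : ℤ) : ℝ := ∫ t in r..1, t ^ (2 * n + 1)

/-- The logarithmic moments `∫ t ^ (2 n + 1) log t` over `(r, 1)`. -/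
def logMoment (r : ℝ) (n : ℤ) : ℝ := ∫ t in r..1, t ^ (2 * n + 1) * Real.log t

lemma integral_conj_zpow_mul {r : ℝ} (hr : 0 ≤ r) {f : ℂ → ℂ}
    (hf : DifferentiableOn ℂ f (annulus r)) (n : ℤ) {ρ : ℝ} (hρ : ρ ∈ Set.Ioo r 1)
    (hint : IntegrableOn (fun w => (starRingEnd ℂ) (w ^ n) * f w) (annulus r)) :
    ∫ w in annulus r, (starRingEnd ℂ) (w ^ n) * f w = (moment r n : ℂ) * laurent n f ρ := by
  have h := integral_radial_mul_conj_zpow hr hf n (fun _ => 1) hρ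
    (by simpa only [Complex.ofReal_one, one_mul] using hint)
  simpa only [Complex.ofReal_one, one_mul, mul_one, moment] using h

lemma differentiableOn_zpow_annulus {r : ℝ} (hr : 0 ≤ r) (n : ℤ) :
    DifferentiableOn ℂ (fun w : ℂ => w ^ n) (annulus r) := fun _ hw =>
  (differentiableAt_zpow.mpr (Or.inl (norm_pos_iff.mp (hr.trans_lt hw.1)))).differentiableWithinAt

/-- The exponents `ν i` are those of the square integrable monomials on `annulus r`, and no other
ones occur in the Laurent expansions of elements of the Bergman space. -/
structure IsMonomialIndex (r : ℝ) {ι : Type} (ν : ι → ℤ) : Prop where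
  nonneg : 0 ≤ r
  lt_one : r < 1
  injective : Function.Injective ν
  memLp : ∀ i, MemLp (fun w : ℂ => w ^ ν i) 2 ((volume : Measure ℂ).restrict (annulus r))
  laurent_eq_zero : ∀ f : space (annulus r), ∀ n, n ∉ Set.range ν → ∀ t ∈ Set.Ioo r 1,
    laurent n (rep f) t = 0

namespace IsMonomialIndex

variable {r : ℝ} {ι : Type} {ν : ι → ℤ}

/-- The monomial `w ^ ν i` as an element of the Bergman space. -/
def monomial (H : IsMonomialIndex r ν) (i : ι) : space (annulus r) :=
  ⟨(H.memLp i).toLp, _, differentiableOn_zpow_annulus H.nonneg (ν i), (H.memLp i).coeFn_toLp⟩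

lemma rep_monomial (H : IsMonomialIndex r ν) (i : ι) :
    Set.EqOn (rep (H.monomial i)) (fun w => w ^ ν i) (annulus r) :=
  rep_eqOn _ (differentiableOn_zpow_annulus H.nonneg (ν i)) (H.memLp i).coeFn_toLp

lemma inner_monomial (H : IsMonomialIndex r ν) (i : ι) (f : space (annulus r)) {ρ : ℝ}
    (hρ : ρ ∈ Set.Ioo r 1) :
    inner ℂ (H.monomial i) f = (moment r (ν i) : ℂ) * laurent (ν i) (rep f) ρ := by
  change inner ℂ (H.memLp i).toLp f.1 = _
  rw [← toLp_rep f, inner_toLp]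
  exact integral_conj_zpow_mul H.nonneg (differentiableOn_rep f) _ hρ
    (integrable_conj_mul (H.memLp i) (memLp_rep f))

lemma exists_mem (H : IsMonomialIndex r ν) : ∃ ρ, ρ ∈ Set.Ioo r 1 := exists_between H.lt_one

lemma laurent_monomial (H : IsMonomialIndex r ν) (i : ι) (n : ℤ) {ρ : ℝ} (hρ : ρ ∈ Set.Ioo r 1) :
    laurent n (rep (H.monomial i)) ρ = if ν i = n then (2 * Real.pi : ℂ) else 0 := by
  rw [← laurent_zpow (ν i) n (H.nonneg.trans_lt hρ.1), laurent, laurent]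
  congr 1
  ext θ
  rw [H.rep_monomial i (circleMap_mem_annulus H.nonneg hρ θ)]

lemma inner_monomial_monomial (H : IsMonomialIndex r ν) (i j : ι) :
    inner ℂ (H.monomial i) (H.monomial j)
      = if ν j = ν i then ((2 * Real.pi * moment r (ν i) : ℝ) : ℂ) else 0 := by
  obtain ⟨ρ, hρ⟩ := H.exists_mem
  rw [H.inner_monomial i _ hρ, H.laurent_monomial j _ hρ]
  split_ifs <;> push_cast <;> ring

lemma norm_monomial_sq (H : IsMonomialIndex r ν) (i : ι) :
    ‖H.monomial i‖ ^ 2 = 2 * Real.pi * moment r (ν i) := by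
  have h := H.inner_monomial_monomial i i
  rw [if_pos rfl, space_inner_self] at h
  exact_mod_cast h

/-- The moment is the squared norm of the monomial up to `2 π`, and the monomial is nonzero since
one of its Laurent coefficients is `2 π`. -/
lemma moment_pos (H : IsMonomialIndex r ν) (i : ι) : 0 < moment r (ν i) := by
  have h0 : H.monomial i ≠ 0 := by
    intro h
    obtain ⟨ρ, hρ⟩ := H.exists_mem
    have h2 := H.inner_monomial i (H.monomial i) hρ
    have h3 := H.laurent_monomial i (ν i) hρ
    rw [h] at h3
    have h4 : Set.EqOn (rep (0 : space (annulus r))) 0 (annulus r) :=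
      rep_eqOn _ (differentiableOn_const 0) (Lp.coeFn_zero _ _ _)
    have h5 : laurent (ν i) (rep (0 : space (annulus r))) ρ = 0 := by
      rw [laurent]
      refine (intervalIntegral.integral_congr fun θ _ => ?_).trans intervalIntegral.integral_zero
      simp only [h4 (circleMap_mem_annulus H.nonneg hρ θ), Pi.zero_apply, mul_zero]
    rw [h5, if_pos rfl] at h3
    have := Real.pi_ne_zero
    exact this (by simpa using h3.symm)
  have h1 : 0 < ‖H.monomial i‖ ^ 2 := by positivity
  rw [H.norm_monomial_sq] at h1
  exact pos_of_mul_pos_right h1 Real.two_pi_pos.le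

/-- The normalized monomials. -/
def unit (H : IsMonomialIndex r ν) (i : ι) : space (annulus r) :=
  ((‖H.monomial i‖⁻¹ : ℝ) : ℂ) • H.monomial i

lemma norm_monomial_pos (H : IsMonomialIndex r ν) (i : ι) : 0 < ‖H.monomial i‖ := by
  have h : 0 < ‖H.monomial i‖ ^ 2 := by
    rw [H.norm_monomial_sq]
    have := H.moment_pos i
    positivity
  exact (norm_nonneg _).lt_of_ne fun h0 => by simp [← h0] at h

lemma orthonormal_unit (H : IsMonomialIndex r ν) : Orthonormal ℂ H.unit := by
  constructor
  · intro i
    have h := H.norm_monomial_pos i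
    rw [unit, norm_smul, Complex.norm_real, norm_inv, norm_norm, inv_mul_cancel₀ h.ne']
  · intro i j hij
    rw [unit, unit, space_inner_smul_left, space_inner_smul_right, H.inner_monomial_monomial,
      if_neg fun h => hij (H.injective h).symm]
    simp

/-- Orthogonality to the monomials kills the Laurent coefficients with index in the range of `ν`;
the others vanish by `laurent_eq_zero`. A function without Laurent coefficients is zero. -/
lemma span_unit_orthogonal (H : IsMonomialIndex r ν) :
    (Submodule.span ℂ (Set.range H.unit))ᗮ = ⊥ := by
  rw [Submodule.eq_bot_iff]
  intro f hf
  have hmon : ∀ i, inner ℂ (H.monomial i) f = 0 := by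
    intro i
    have h := (Submodule.mem_orthogonal _ f).mp hf (H.unit i) (Submodule.subset_span ⟨i, rfl⟩)
    rw [unit, space_inner_smul_left] at h
    refine (mul_eq_zero.mp h).resolve_left ?_
    simpa using (norm_pos_iff.mp (H.norm_monomial_pos i))
  have hl : ∀ n, ∀ t ∈ Set.Ioo r 1, laurent n (rep f) t = 0 := by
    intro n t ht
    by_cases hn : n ∈ Set.range ν
    · obtain ⟨i, rfl⟩ := hn
      have h := hmon i
      rw [H.inner_monomial i f ht] at h
      exact (mul_eq_zero.mp h).resolve_left (by exact_mod_cast (H.moment_pos i).ne')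
    · exact H.laurent_eq_zero f n hn t ht
  have hz : ∀ z ∈ annulus r, rep f z = 0 := fun z hz =>
    eq_zero_of_laurent_eq_zero H.nonneg (differentiableOn_rep f) hl hz
  apply Subtype.ext
  apply Lp.ext
  filter_upwards [coeFn_ae_eq_rep f, Lp.coeFn_zero ℂ 2 ((volume : Measure ℂ).restrict (annulus r)),
    ae_restrict_mem (annulus r).isOpen.measurableSet] with z h1 h2 h3
  rw [h1, hz z h3]
  exact h2.symm

/-- The normalized monomials form a Hilbert basis of the Bergman space. -/
def basis (H : IsMonomialIndex r ν) : HilbertBasis ι ℂ (space (annulus r)) :=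
  HilbertBasis.mkOfOrthogonalEqBot H.orthonormal_unit H.span_unit_orthogonal

lemma basis_apply (H : IsMonomialIndex r ν) (i : ι) : H.basis i = H.unit i := by
  simp [basis]

/-- By the reproducing property the product is the squared modulus of the normalized monomial at
`z`. -/
lemma inner_kernelFun_unit_mul (H : IsMonomialIndex r ν) (z : annulus r) (i : ι) :
    inner ℂ (kernelFun z) (H.unit i) * inner ℂ (H.unit i) (kernelFun z)
      = ((‖(z : ℂ)‖ ^ (2 * ν i) / (2 * Real.pi * moment r (ν i)) : ℝ) : ℂ) := by
  have h : inner ℂ (kernelFun z) (H.unit i) = ((‖H.monomial i‖⁻¹ : ℝ) : ℂ) * (z : ℂ) ^ ν i := by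
    rw [unit, space_inner_smul_right, inner_kernelFun, apply_eq_rep, H.rep_monomial i z.2]
  rw [← inner_conj_symm (H.unit i), Complex.mul_conj', h, norm_mul, Complex.norm_real, norm_inv,
    norm_norm, norm_zpow]
  have h2 := H.norm_monomial_sq i
  rw [← h2, ← Complex.ofReal_pow, mul_pow, mul_comm (2 : ℤ), zpow_mul, div_eq_inv_mul, inv_pow]
  norm_cast

lemma kernel_self (H : IsMonomialIndex r ν) (z : annulus r) :
    kernel (annulus r) z z
      = ((∑' i, ‖(z : ℂ)‖ ^ (2 * ν i) / (2 * Real.pi * moment r (ν i)) : ℝ) : ℂ) := by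
  have h := H.basis.hasSum_inner_mul_inner (kernelFun z) (kernelFun z)
  simp only [H.basis_apply, H.inner_kernelFun_unit_mul] at h
  rw [inner_kernelFun, kernelFun_apply] at h
  rw [Complex.ofReal_tsum]
  exact h.tsum_eq.symm

/-- Paired with an element of the Bergman space, the projection disappears. The radial weight then
replaces the moment by the logarithmic moment and leaves the Laurent coefficient alone. -/
lemma inner_monomial_toeplitz (H : IsMonomialIndex r ν) {T : space (annulus r) →L[ℂ] space (annulus r)}
    (hT : IsToeplitz logNorm T) (i : ι) (f : space (annulus r)) :
    inner ℂ (H.monomial i) (T f)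
      = ((logMoment r (ν i) / moment r (ν i) : ℝ) : ℂ) * inner ℂ (H.monomial i) f := by
  obtain ⟨ρ, hρ⟩ := H.exists_mem
  obtain ⟨h, hf⟩ := hT f
  rw [hf, projection, Submodule.inner_orthogonalProjectionOnto_eq_of_mem_left]
  change inner ℂ (H.memLp i).toLp _ = _
  rw [inner_toLp]
  refine (integral_radial_mul_conj_zpow H.nonneg (differentiableOn_rep f) (ν i) Real.log hρ
    (integrable_conj_mul (H.memLp i) h)).trans ?_
  rw [H.inner_monomial i f hρ]
  have : (moment r (ν i) : ℂ) ≠ 0 := by exact_mod_cast (H.moment_pos i).ne'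
  push_cast
  rw [← mul_assoc, div_mul_cancel₀ _ this, logMoment]

lemma inner_toeplitz_kernelFun (H : IsMonomialIndex r ν)
    {T : space (annulus r) →L[ℂ] space (annulus r)} (hT : IsToeplitz logNorm T) (z : annulus r) :
    inner ℂ (kernelFun z) (T (kernelFun z))
      = ((∑' i, ‖(z : ℂ)‖ ^ (2 * ν i) / (2 * Real.pi * moment r (ν i))
          * (logMoment r (ν i) / moment r (ν i)) : ℝ) : ℂ) := by
  have h := H.basis.hasSum_inner_mul_inner (kernelFun z) (T (kernelFun z))
  have hterm : ∀ i, inner ℂ (kernelFun z) (H.unit i) * inner ℂ (H.unit i) (T (kernelFun z))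
      = ((‖(z : ℂ)‖ ^ (2 * ν i) / (2 * Real.pi * moment r (ν i))
          * (logMoment r (ν i) / moment r (ν i)) : ℝ) : ℂ) := by
    intro i
    rw [Complex.ofReal_mul, ← H.inner_kernelFun_unit_mul]
    simp only [unit, space_inner_smul_left, H.inner_monomial_toeplitz hT]
    ring
  simp only [H.basis_apply, hterm] at h
  rw [Complex.ofReal_tsum]
  exact h.tsum_eq.symm

/-- The Berezin transform of `log |z|` as a quotient of power series. -/
lemma berezin_eq (H : IsMonomialIndex r ν) (hb : IsBoundedSymbol (annulus r) logNorm) {z : ℂ}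
    (hz : z ∈ annulus r) :
    berezin (annulus r) logNorm z
      = (((∑' i, ‖z‖ ^ (2 * ν i) / (2 * Real.pi * moment r (ν i))
          * (logMoment r (ν i) / moment r (ν i)))
        / ∑' i, ‖z‖ ^ (2 * ν i) / (2 * Real.pi * moment r (ν i)) : ℝ) : ℂ) := by
  obtain ⟨T, hT⟩ := hb
  rw [berezin, dif_pos hz, hT.toeplitz_eq, berezinOp, normalizedKernel, map_smul, space_inner_smul_left,
    space_inner_smul_right, H.inner_toeplitz_kernelFun hT, H.kernel_self, Complex.ofReal_re]
  have hD : 0 ≤ ∑' i, ‖z‖ ^ (2 * ν i) / (2 * Real.pi * moment r (ν i)) :=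
    tsum_nonneg fun i => by have := H.moment_pos i; positivity
  rw [← Complex.ofReal_inv, Complex.conj_ofReal, ← mul_assoc, ← Complex.ofReal_mul,
    ← Complex.ofReal_mul, ← mul_inv, Real.mul_self_sqrt hD, div_eq_inv_mul]

end IsMonomialIndex

/-! Boundedness of the Toeplitz operators. -/

lemma isBoundedSymbol_of_norm_le {Ω : TopologicalSpace.Opens ℂ} {φ : ℂ → ℂ} {C : ℝ}
    (h : ∀ f : space Ω, ∃ hm : MemLp (fun w => φ w * rep f w) 2 ((volume : Measure ℂ).restrict Ω),
      ‖hm.toLp‖ ≤ C * ‖f‖) : IsBoundedSymbol Ω φ := by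
  choose hm hC using h
  have hae : ∀ᵐ w ∂(volume : Measure ℂ).restrict Ω, w ∈ (Ω : Set ℂ) :=
    ae_restrict_mem Ω.isOpen.measurableSet
  let S : space Ω →ₗ[ℂ] Lp ℂ 2 ((volume : Measure ℂ).restrict Ω) :=
    { toFun := fun f => (hm f).toLp
      map_add' := fun f g => by
        rw [← MemLp.toLp_add]
        refine (MemLp.toLp_eq_toLp_iff _ _).mpr ?_
        filter_upwards [hae] with w hw
        simp only [rep_add f g hw, Pi.add_apply, mul_add]
      map_smul' := fun c f => by
        rw [RingHom.id_apply, ← MemLp.toLp_const_smul]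
        refine (MemLp.toLp_eq_toLp_iff _ _).mpr ?_
        filter_upwards [hae] with w hw
        simp only [rep_smul c f hw, Pi.smul_apply, smul_eq_mul]
        ring }
  exact ⟨(projection Ω).comp (S.mkContinuous C hC), fun f => ⟨hm f, rfl⟩⟩

lemma measurable_logNorm : Measurable logNorm :=
  Complex.measurable_ofReal.comp (Real.measurable_log.comp measurable_norm)

lemma isBoundedSymbol_annulus {r : ℝ} (hr : 0 < r) : IsBoundedSymbol (annulus r) logNorm := by
  refine isBoundedSymbol_of_norm_le (C := -Real.log r) fun f => ?_
  have hb : ∀ᵐ w ∂(volume : Measure ℂ).restrict (annulus r),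
      ‖logNorm w * rep f w‖ ≤ -Real.log r * ‖rep f w‖ := by
    filter_upwards [ae_restrict_mem (annulus r).isOpen.measurableSet] with w hw
    rw [norm_mul]
    gcongr
    rw [logNorm, Complex.norm_real, Real.norm_eq_abs, abs_of_nonpos
      (Real.log_nonpos (norm_nonneg w) hw.2.le)]
    exact neg_le_neg (Real.log_le_log hr hw.1.le)
  have hm : MemLp (fun w => logNorm w * rep f w) 2 ((volume : Measure ℂ).restrict (annulus r)) :=
    (memLp_rep f).of_le_mul
      (measurable_logNorm.aestronglyMeasurable.mul (memLp_rep f).aestronglyMeasurable) hb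
  refine ⟨hm, ?_⟩
  refine Lp.norm_le_mul_norm_of_ae_le_mul (g := f.1) ?_
  filter_upwards [hb, hm.coeFn_toLp, coeFn_ae_eq_rep f] with w h1 h2 h3
  rw [h2, h3]
  exact h1

/-! Square integrable monomials. -/

lemma annulus_subset_ball (r : ℝ) : (annulus r : Set ℂ) ⊆ Metric.ball 0 1 := fun w hw => by
  simpa using hw.2

instance (r : ℝ) : IsFiniteMeasure ((volume : Measure ℂ).restrict (annulus r)) :=
  ⟨by
    rw [Measure.restrict_apply_univ]
    exact (measure_mono (annulus_subset_ball r)).trans_lt measure_ball_lt_top⟩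

lemma memLp_zpow_of_norm_le {r : ℝ} (hr : 0 ≤ r) (n : ℤ) {C : ℝ}
    (hC : ∀ w ∈ annulus r, ‖w‖ ^ n ≤ C) :
    MemLp (fun w : ℂ => w ^ n) 2 ((volume : Measure ℂ).restrict (annulus r)) := by
  refine MemLp.of_bound ((differentiableOn_zpow_annulus hr n).continuousOn.aestronglyMeasurable
    (annulus r).isOpen.measurableSet) C ?_
  filter_upwards [ae_restrict_mem (annulus r).isOpen.measurableSet] with w hw
  rw [norm_zpow]
  exact hC w hw

lemma isMonomialIndex_int {r : ℝ} (hr : 0 < r) (hr1 : r < 1) :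
    IsMonomialIndex r (id : ℤ → ℤ) where
  nonneg := hr.le
  lt_one := hr1
  injective := Function.injective_id
  memLp n := by
    -- The bound is `1` for `n ≥ 0` and `r ^ n` for `n ≤ 0`; the sum covers both.
    refine memLp_zpow_of_norm_le hr.le n (C := 1 + r ^ n) fun w hw => ?_
    have hw0 : 0 < ‖w‖ := hr.trans hw.1
    rcases le_total 0 n with hn | hn
    · have h1 : ‖w‖ ^ n ≤ 1 := zpow_le_one₀ hw0 hw.2.le hn
      have := zpow_pos hr n
      linarith
    · have h1 : ‖w‖ ^ n ≤ r ^ n := by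
        obtain ⟨m, rfl⟩ : ∃ m : ℕ, n = -(m : ℤ) := ⟨n.natAbs, by omega⟩
        rw [zpow_neg, zpow_neg, zpow_natCast, zpow_natCast]
        exact inv_anti₀ (pow_pos hr m) (pow_le_pow_left₀ hr.le hw.1.le m)
      linarith
  laurent_eq_zero f n hn := (hn ⟨n, rfl⟩).elim

/-- Compares `t ^ (2 n + 1)` with `t⁻¹` on `(0, 1]`. The moments of negative index thus diverge as
`r → 0`. -/
lemma neg_log_le_moment {r : ℝ} (hr : 0 < r) (hr1 : r ≤ 1) {n : ℤ} (hn : n < 0) :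
    -Real.log r ≤ moment r n := by
  have hmem : (0 : ℝ) ∉ Set.uIcc r 1 := by
    rw [Set.uIcc_of_le hr1]
    exact fun h => absurd h.1 (not_le.mpr hr)
  have h1 : ∫ t in r..1, t ^ (-1 : ℤ) = -Real.log r := by
    simp only [zpow_neg_one]
    rw [integral_inv_of_pos hr one_pos, one_div, Real.log_inv]
  rw [← h1, moment]
  refine intervalIntegral.integral_mono_on hr1 (intervalIntegral.intervalIntegrable_zpow (Or.inr hmem))
    (intervalIntegral.intervalIntegrable_zpow (Or.inr hmem)) fun t ht => ?_
  exact zpow_le_zpow_right_of_le_one₀ (hr.trans_le ht.1) ht.2 (by omega)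

/-! ### Negative Laurent coefficients at the puncture. -/

lemma annulus_anti {r s : ℝ} (h : r ≤ s) : (annulus s : Set ℂ) ⊆ annulus r := fun _ hw =>
  ⟨h.trans_lt hw.1, hw.2⟩

lemma exists_restrict {Ω Ω' : TopologicalSpace.Opens ℂ} (h : (Ω' : Set ℂ) ⊆ Ω) (f : space Ω) :
    ∃ g : space Ω', Set.EqOn (rep g) (rep f) Ω' ∧ ‖g‖ ≤ ‖f‖ := by
  have hle : (volume : Measure ℂ).restrict Ω' ≤ volume.restrict Ω := Measure.restrict_mono h le_rfl
  have hm : MemLp (rep f) 2 ((volume : Measure ℂ).restrict Ω') := (memLp_rep f).mono_measure hle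
  have hd : DifferentiableOn ℂ (rep f) Ω' := (differentiableOn_rep f).mono h
  refine ⟨⟨hm.toLp, _, hd, hm.coeFn_toLp⟩, rep_eqOn _ hd hm.coeFn_toLp, ?_⟩
  change ‖hm.toLp‖ ≤ ‖f.1‖
  rw [← toLp_rep f, Lp.norm_toLp, Lp.norm_toLp]
  exact ENNReal.toReal_mono (memLp_rep f).2.ne (eLpNorm_mono_measure _ hle)

/-- Cauchy–Schwarz against `w ^ n` on the annulus of inner radius `δ` gives `moment δ n * ‖L‖² ≤ 2 π
‖f‖²` for the coefficient `L`. The left side is unbounded as `δ → 0` unless `L = 0`. -/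
lemma laurent_eq_zero_of_neg (f : space (annulus 0)) {n : ℤ} (hn : n < 0) {ρ : ℝ}
    (hρ : ρ ∈ Set.Ioo (0 : ℝ) 1) : laurent n (rep f) ρ = 0 := by
  by_contra hL
  set L := laurent n (rep f) ρ with hLdef
  have hLpos : 0 < ‖L‖ ^ 2 := by positivity
  have hev : ∀ᶠ δ : ℝ in 𝓝[>] 0, 2 * Real.pi * ‖f‖ ^ 2 / ‖L‖ ^ 2 < -Real.log δ :=
    (tendsto_neg_atBot_atTop.comp Real.tendsto_log_nhdsGT_zero).eventually_gt_atTop _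
  obtain ⟨δ, hδ, hδρ⟩ := (hev.and (Ioo_mem_nhdsGT hρ.1)).exists
  have hδ1 : δ < 1 := hδρ.2.trans hρ.2
  have H := isMonomialIndex_int hδρ.1 hδ1
  obtain ⟨g, hg, hgf⟩ := exists_restrict (annulus_anti hδρ.1.le) f
  have hgL : laurent n (rep g) ρ = L := by
    rw [hLdef, laurent, laurent]
    congr 1
    ext θ
    rw [hg (circleMap_mem_annulus hδρ.1.le ⟨hδρ.2, hρ.2⟩ θ)]
  have h1 := norm_inner_le_norm (𝕜 := ℂ) (H.monomial n) g
  have hI : 0 < moment δ n := H.moment_pos n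
  have h3 := H.norm_monomial_sq n
  rw [H.inner_monomial n g ⟨hδρ.2, hρ.2⟩, id, hgL, norm_mul, Complex.norm_real,
    Real.norm_of_nonneg hI.le] at h1
  rw [id] at h3
  have h4 : (moment δ n * ‖L‖) ^ 2 ≤ (‖H.monomial n‖ * ‖f‖) ^ 2 := by
    refine pow_le_pow_left₀ (by positivity) (h1.trans ?_) 2
    exact mul_le_mul_of_nonneg_left hgf (norm_nonneg _)
  rw [mul_pow, mul_pow, h3] at h4
  have h5 : moment δ n * ‖L‖ ^ 2 ≤ 2 * Real.pi * ‖f‖ ^ 2 := by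
    refine le_of_mul_le_mul_left ?_ hI
    nlinarith
  rw [← le_div_iff₀ hLpos] at h5
  linarith [neg_log_le_moment hδρ.1 hδ1.le hn]

lemma isMonomialIndex_nat : IsMonomialIndex 0 (fun n : ℕ => (n : ℤ)) where
  nonneg := le_rfl
  lt_one := one_pos
  injective := Nat.cast_injective
  memLp n := memLp_zpow_of_norm_le le_rfl n (C := 1) fun w hw => by
    exact zpow_le_one₀ hw.1 hw.2.le (Int.natCast_nonneg n)
  laurent_eq_zero f n hn t ht := laurent_eq_zero_of_neg f
    (by by_contra h; exact hn ⟨n.toNat, by simp; omega⟩) ht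

lemma moment_zero (n : ℕ) : moment 0 n = (2 * ((n : ℝ) + 1))⁻¹ := by
  rw [moment, integral_zpow (Or.inl (by positivity))]
  rw [zero_zpow _ (by omega), one_zpow]
  push_cast
  rw [sub_zero, one_div]
  congr 1
  ring

lemma hasSum_succ_mul_geometric {x : ℝ} (h0 : 0 ≤ x) (h1 : x < 1) :
    HasSum (fun n : ℕ => ((n : ℝ) + 1) * x ^ n) (1 / (1 - x) ^ 2) := by
  have hx : ‖x‖ < 1 := by rwa [Real.norm_of_nonneg h0]
  have h := (hasSum_coe_mul_geometric_of_norm_lt_one hx).add (hasSum_geometric_of_lt_one h0 h1)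
  have hne : 1 - x ≠ 0 := by linarith
  rw [show 1 / (1 - x) ^ 2 = x / (1 - x) ^ 2 + (1 - x)⁻¹ by field_simp; ring]
  exact h.congr_fun fun n => by ring

lemma zpow_two_mul_natCast (s : ℝ) (n : ℕ) : s ^ (2 * (n : ℤ)) = (s ^ 2) ^ n := by
  rw [zpow_mul, zpow_natCast]; norm_cast

lemma hasSum_kernel_zero {s : ℝ} (h0 : 0 ≤ s) (h1 : s < 1) :
    HasSum (fun n : ℕ => s ^ (2 * (n : ℤ)) / (2 * Real.pi * moment 0 n))
      (1 / (Real.pi * (1 - s ^ 2) ^ 2)) := by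
  have h := (hasSum_succ_mul_geometric (sq_nonneg s) (by nlinarith)).div_const Real.pi
  rw [div_div, mul_comm _ Real.pi] at h
  refine h.congr_fun fun n => ?_
  rw [moment_zero, zpow_two_mul_natCast]
  have : (n : ℝ) + 1 ≠ 0 := by positivity
  field_simp

/-- Cauchy–Schwarz with the reproducing kernel; the constant is the square root of the kernel on the
diagonal. -/
lemma norm_rep_le_of_annulus_zero (f : space (annulus 0)) {z : ℂ} (hz : z ∈ annulus 0) :
    ‖rep f z‖ ≤ (Real.sqrt Real.pi)⁻¹ / (1 - ‖z‖ ^ 2) * ‖f‖ := by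
  have hs : 0 < 1 - ‖z‖ ^ 2 := by nlinarith [hz.1, hz.2]
  have h1 := norm_inner_le_norm (𝕜 := ℂ) (kernelFun ⟨z, hz⟩) f
  rw [inner_kernelFun, apply_eq_rep] at h1
  refine h1.trans (mul_le_mul_of_nonneg_right ?_ (norm_nonneg f))
  have h2 := isMonomialIndex_nat.kernel_self ⟨z, hz⟩
  rw [(hasSum_kernel_zero hz.1.le hz.2).tsum_eq, ← kernelFun_apply, ← inner_kernelFun,
    space_inner_self] at h2
  have h3 : ‖kernelFun (⟨z, hz⟩ : annulus 0)‖ ^ 2 = 1 / (Real.pi * (1 - ‖z‖ ^ 2) ^ 2) := by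
    exact_mod_cast h2
  refine le_of_sq_le_sq ?_ (by positivity)
  rw [h3, div_pow, inv_pow, Real.sq_sqrt Real.pi_pos.le]
  exact le_of_eq (by field_simp)

/-- The factor `1 - s²` absorbs the growth of point evaluations at the unit circle, and `s ^ (-1/2)`
is square integrable in the plane near `0`. The estimate is `log x ≥ 1 - x⁻¹` at `x = √s`. -/
lemma abs_log_le {s : ℝ} (h0 : 0 < s) (h1 : s < 1) :
    |Real.log s| ≤ 2 * (1 - s ^ 2) * (Real.sqrt s)⁻¹ := by
  rw [abs_of_neg (Real.log_neg h0 h1)]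
  have hq : 0 < Real.sqrt s := Real.sqrt_pos.mpr h0
  have h2 := Real.one_sub_inv_le_log_of_pos hq
  rw [Real.log_sqrt h0.le] at h2
  have hs := Real.sq_sqrt h0.le
  have hq1 : Real.sqrt s < 1 := by rw [Real.sqrt_lt' one_pos]; simpa using h1
  have h3 : 1 - Real.sqrt s ≤ 1 - s ^ 2 := by nlinarith
  have h4 : (Real.sqrt s)⁻¹ - 1 = (1 - Real.sqrt s) * (Real.sqrt s)⁻¹ := by
    field_simp
  have h5 := mul_le_mul_of_nonneg_right h3 (inv_pos.mpr hq).le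
  linarith

lemma memLp_inv_sqrt_norm :
    MemLp (fun w : ℂ => (Real.sqrt ‖w‖)⁻¹) 2 ((volume : Measure ℂ).restrict (annulus 0)) := by
  have hmeas : Measurable fun w : ℂ => (Real.sqrt ‖w‖)⁻¹ := by fun_prop
  rw [memLp_two_iff_integrable_sq hmeas.aestronglyMeasurable]
  refine IntegrableOn.mono_set (t := Metric.ball 0 1) ?_ (annulus_subset_ball 0)
  refine integrableOn_ball_of_norm_le_rpow (C := 1) (α := 1)
    (by simp) (by simp) (Eventually.of_forall fun w => ?_)
    (hmeas.pow_const 2).aestronglyMeasurable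
  rw [inv_pow, Real.sq_sqrt (norm_nonneg w), Real.rpow_neg_one, one_mul, norm_inv, norm_norm]

/-- The symbol is unbounded near `0`, but the pointwise bound on `f` makes `φ f` at most a constant
times `‖f‖ |w| ^ (-1/2)`, a fixed square integrable function scaled by `‖f‖`. -/
lemma isBoundedSymbol_annulus_zero : IsBoundedSymbol (annulus 0) logNorm := by
  have hg := memLp_inv_sqrt_norm
  refine isBoundedSymbol_of_norm_le (C := 2 * (Real.sqrt Real.pi)⁻¹ * ‖hg.toLp‖) fun f => ?_
  have hb : ∀ᵐ w ∂(volume : Measure ℂ).restrict (annulus 0), ‖logNorm w * rep f w‖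
      ≤ (2 * (Real.sqrt Real.pi)⁻¹ * ‖f‖) * ‖(Real.sqrt ‖w‖)⁻¹‖ := by
    filter_upwards [ae_restrict_mem (annulus 0).isOpen.measurableSet] with w hw
    have hs : 0 < 1 - ‖w‖ ^ 2 := by nlinarith [hw.1, hw.2]
    rw [norm_mul, logNorm, Complex.norm_real, Real.norm_eq_abs, norm_inv,
      Real.norm_of_nonneg (Real.sqrt_nonneg _)]
    refine (mul_le_mul (abs_log_le hw.1 hw.2) (norm_rep_le_of_annulus_zero f hw) (norm_nonneg _)
      (by positivity)).trans (le_of_eq ?_)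
    field_simp
  have hm : MemLp (fun w => logNorm w * rep f w) 2 ((volume : Measure ℂ).restrict (annulus 0)) :=
    hg.of_le_mul
      (measurable_logNorm.aestronglyMeasurable.mul (memLp_rep f).aestronglyMeasurable) hb
  refine ⟨hm, ?_⟩
  rw [mul_right_comm]
  refine Lp.norm_le_mul_norm_of_ae_le_mul ?_
  filter_upwards [hb, hm.coeFn_toLp, hg.coeFn_toLp] with w h1 h2 h3
  rw [h2, h3]
  exact h1

/-! The Berezin transform on the punctured disc. -/

lemma pow_mul_log_eq (n : ℕ) (t : ℝ) :
    t ^ (2 * (n : ℤ) + 1) * Real.log t = t ^ (2 * n) * (t * Real.log t) := by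
  rw [← mul_assoc, ← pow_succ]
  norm_cast

lemma continuous_pow_mul_log (n : ℕ) :
    Continuous fun t : ℝ => t ^ (2 * (n : ℤ) + 1) * Real.log t := by
  simp only [pow_mul_log_eq]
  exact (continuous_pow _).mul Real.continuous_mul_log

lemma logMoment_zero (n : ℕ) : logMoment 0 n = -((2 * ((n : ℝ) + 1)) ^ 2)⁻¹ := by
  have hn : (n : ℝ) + 1 ≠ 0 := by positivity
  have hc : Continuous fun t : ℝ => t ^ (2 * n + 2) * Real.log t := by
    have : (fun t : ℝ => t ^ (2 * n + 2) * Real.log t)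
        = fun t => t ^ (2 * n + 1) * (t * Real.log t) := by
      ext t; ring
    rw [this]
    exact (continuous_pow _).mul Real.continuous_mul_log
  -- Integration by parts gives the antiderivative; this form asks only for its continuity at `0`.
  have h := intervalIntegral.integral_eq_sub_of_hasDeriv_right_of_le (a := 0) (b := 1) zero_le_one
    (f := fun t : ℝ => t ^ (2 * n + 2) * Real.log t / (2 * (n + 1))
      - t ^ (2 * n + 2) / (2 * ((n : ℝ) + 1)) ^ 2)
    (f' := fun t : ℝ => t ^ (2 * (n : ℤ) + 1) * Real.log t)
    ((hc.div_const _).sub ((continuous_pow _).div_const _)).continuousOn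
    (fun t ht => ?_) ((continuous_pow_mul_log n).intervalIntegrable _ _)
  · rw [logMoment, h]
    simp
  · have ht0 : t ≠ 0 := ht.1.ne'
    have h1 := (hasDerivAt_pow (2 * n + 2) t)
    have h2 := ((h1.mul (Real.hasDerivAt_log ht0)).div_const (2 * ((n : ℝ) + 1))).sub
      (h1.div_const ((2 * ((n : ℝ) + 1)) ^ 2))
    refine (h2.congr_deriv ?_).hasDerivWithinAt
    rw [pow_mul_log_eq]
    push_cast
    field_simp
    simp only [pow_succ]
    ring

/-- The eigenvalue `-1 / (2 (n + 1))` cancels the factor `n + 1` of the kernel term, leaving a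
geometric series. -/
lemma hasSum_logKernel_zero {s : ℝ} (h0 : 0 ≤ s) (h1 : s < 1) :
    HasSum (fun n : ℕ => s ^ (2 * (n : ℤ)) / (2 * Real.pi * moment 0 n)
      * (logMoment 0 n / moment 0 n)) (-(1 / (2 * Real.pi * (1 - s ^ 2)))) := by
  have h := (hasSum_geometric_of_lt_one (sq_nonneg s) (by nlinarith)).mul_right
    (-(1 / (2 * Real.pi)))
  have hne : 1 - s ^ 2 ≠ 0 := by nlinarith
  rw [show -(1 / (2 * Real.pi * (1 - s ^ 2))) = (1 - s ^ 2)⁻¹ * -(1 / (2 * Real.pi)) by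
    field_simp]
  refine h.congr_fun fun n => ?_
  rw [moment_zero, logMoment_zero, zpow_two_mul_natCast]
  have : (n : ℝ) + 1 ≠ 0 := by positivity
  field_simp

lemma berezin_puncturedDisc {z : ℂ} (hz : z ∈ puncturedDisc) :
    berezin puncturedDisc logNorm z = (((‖z‖ ^ 2 - 1) / 2 : ℝ) : ℂ) := by
  rw [← annulus_zero] at hz ⊢
  rw [isMonomialIndex_nat.berezin_eq isBoundedSymbol_annulus_zero hz,
    (hasSum_kernel_zero hz.1.le hz.2).tsum_eq, (hasSum_logKernel_zero hz.1.le hz.2).tsum_eq]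
  have hs : 1 - ‖z‖ ^ 2 ≠ 0 := by nlinarith [hz.1, hz.2]
  congr 1
  field_simp
  ring

/-! Bounds on the moments. -/

lemma continuous_zpow_odd (n : ℕ) : Continuous fun t : ℝ => t ^ (2 * (n : ℤ) + 1) := by
  have : (fun t : ℝ => t ^ (2 * (n : ℤ) + 1)) = fun t => t ^ (2 * n + 1) := by
    ext t; norm_cast
  rw [this]
  exact continuous_pow _

lemma tendsto_integral_zero {f : ℝ → ℝ} (hf : Continuous f) :
    Tendsto (fun r => ∫ t in r..1, f t) (𝓝[>] 0) (𝓝 (∫ t in (0 : ℝ)..1, f t)) := by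
  have h : Continuous fun r => ∫ t in r..1, f t := by
    have h2 := intervalIntegral.continuous_primitive (μ := volume) (fun a b => hf.intervalIntegrable a b) 1
    refine h2.neg.congr fun r => ?_
    rw [intervalIntegral.integral_symm 1 r, Pi.neg_apply]
  exact (h.tendsto 0).mono_left nhdsWithin_le_nhds

lemma tendsto_moment (n : ℕ) : Tendsto (fun r => moment r n) (𝓝[>] 0) (𝓝 (moment 0 n)) :=
  tendsto_integral_zero (continuous_zpow_odd n)

lemma tendsto_logMoment (n : ℕ) :
    Tendsto (fun r => logMoment r n) (𝓝[>] 0) (𝓝 (logMoment 0 n)) :=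
  tendsto_integral_zero (continuous_pow_mul_log n)

lemma le_moment_natCast {r : ℝ} (hr : 0 < r) (hr2 : r < 1 / 2) (n : ℕ) :
    (4 * ((n : ℝ) + 1))⁻¹ ≤ moment r n := by
  rw [moment, integral_zpow (Or.inl (by positivity)), one_zpow]
  have h1 : r ^ (2 * (n : ℤ) + 1 + 1) ≤ 1 / 2 := by
    have : r ^ (2 * (n : ℤ) + 1 + 1) = r * r ^ (2 * n + 1) := by
      rw [← pow_succ']; norm_cast
    rw [this]
    have := pow_le_one₀ (n := 2 * n + 1) hr.le (by linarith)
    nlinarith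
  push_cast
  rw [le_div_iff₀ (by positivity)]
  have hn : (n : ℝ) + 1 ≠ 0 := by positivity
  calc (4 * ((n : ℝ) + 1))⁻¹ * (2 * n + 1 + 1) = 1 / 2 := by field_simp; ring
    _ ≤ _ := by linarith

lemma abs_logMoment_natCast_le {r : ℝ} (hr : 0 < r) (hr1 : r < 1) (n : ℕ) :
    |logMoment r n| ≤ 1 := by
  have h := intervalIntegral.norm_integral_le_of_norm_le_const (a := r) (b := 1) (C := 1)
    (f := fun t : ℝ => t ^ (2 * (n : ℤ) + 1) * Real.log t) (fun t ht => ?_)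
  · rw [abs_of_pos (by linarith)] at h
    rw [← Real.norm_eq_abs]
    exact h.trans (by linarith)
  · rw [Set.uIoc_of_le hr1.le] at ht
    have ht0 := hr.trans ht.1
    rw [pow_mul_log_eq, norm_mul, norm_pow, Real.norm_of_nonneg ht0.le]
    have h1 := pow_le_one₀ (n := 2 * n) ht0.le ht.2
    have h2 := (Real.abs_log_mul_self_lt t ht0 ht.2).le
    rw [mul_comm t, Real.norm_eq_abs]
    nlinarith [abs_nonneg (Real.log t * t), pow_nonneg ht0.le (2 * n)]

lemma moment_neg_one {r : ℝ} (hr : 0 < r) : moment r (-1) = -Real.log r := by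
  rw [moment]
  norm_num
  rw [integral_inv_of_pos hr one_pos, one_div, Real.log_inv]

lemma logMoment_neg_one {r : ℝ} (hr : 0 < r) (hr1 : r < 1) :
    logMoment r (-1) = -(Real.log r) ^ 2 / 2 := by
  have h := intervalIntegral.integral_eq_sub_of_hasDerivAt (a := r) (b := 1)
    (f := fun t : ℝ => Real.log t ^ 2 / 2) (f' := fun t : ℝ => t ^ (2 * (-1 : ℤ) + 1) * Real.log t)
    (fun t ht => ?_) (ContinuousOn.intervalIntegrable fun t ht => ?_)
  · rw [logMoment, h]
    simp
    ring
  · rw [Set.uIcc_of_le hr1.le] at ht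
    have ht0 : t ≠ 0 := (hr.trans_le ht.1).ne'
    refine (((Real.hasDerivAt_log ht0).pow 2).div_const 2).congr_deriv ?_
    norm_num
    ring
  · rw [Set.uIcc_of_le hr1.le] at ht
    have ht0 : t ≠ 0 := (hr.trans_le ht.1).ne'
    exact ((continuousAt_zpow₀ t _ (Or.inl ht0)).mul (Real.continuousAt_log ht0)).continuousWithinAt

/-- The growth `r ^ (-2 k)` makes the kernel terms of index below `-1` vanish in the limit. The case
`k = 0` is logarithmic and needs its own estimate. -/
lemma le_moment_neg {r : ℝ} (hr : 0 < r) (hr2 : r < 1 / 2) (k : ℕ) :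
    (4 * ((k : ℝ) + 1) * r ^ (2 * k))⁻¹ ≤ moment r (-((k : ℤ) + 1)) := by
  rcases Nat.eq_zero_or_pos k with rfl | hk
  · have h1 := Real.one_sub_inv_le_log_of_pos (inv_pos.mpr hr)
    rw [Real.log_inv, inv_inv] at h1
    simp only [Nat.cast_zero, zero_add, mul_zero, pow_zero, mul_one]
    rw [moment_neg_one hr]
    linarith
  · have hmem : (0 : ℝ) ∉ Set.uIcc r 1 := by
      rw [Set.uIcc_of_le (by linarith)]
      exact fun h => absurd h.1 (not_le.mpr hr)
    rw [moment, integral_zpow (Or.inr ⟨by omega, hmem⟩), one_zpow,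
      show 2 * (-((k : ℤ) + 1)) + 1 + 1 = -((2 * k : ℕ) : ℤ) by push_cast; ring, zpow_neg,
      zpow_natCast]
    push_cast
    have hk0 : (0 : ℝ) < k := by exact_mod_cast hk
    have hp : 0 < r ^ (2 * k) := pow_pos hr _
    have h1 : r ^ (2 * k) ≤ 1 / 2 := by
      obtain ⟨m, hm⟩ : ∃ m, 2 * k = m + 1 := ⟨2 * k - 1, by omega⟩
      rw [hm, pow_succ]
      have := pow_le_one₀ (n := m) hr.le (by linarith)
      nlinarith
    rw [show (1 - (r ^ (2 * k))⁻¹) / (2 * -((k : ℝ) + 1) + 1 + 1)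
      = (1 - r ^ (2 * k)) / (2 * k * r ^ (2 * k)) by
        rw [show 2 * -((k : ℝ) + 1) + 1 + 1 = -(2 * k) by ring]; field_simp; ring]
    rw [← one_div, div_le_div_iff₀ (by positivity) (by positivity)]
    nlinarith [mul_pos hk0 hp]

/-- Bounds `|λ n|` by `-log r`. This is crude but enough, since powers of `r` dominate the
logarithm. -/
lemma abs_logMoment_le {r : ℝ} (hr : 0 < r) (hr1 : r < 1) (n : ℤ) :
    |logMoment r n| ≤ -Real.log r * moment r n := by
  have hc : ContinuousOn (fun t : ℝ => t ^ (2 * n + 1)) (Set.uIcc r 1) := fun t ht => by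
    rw [Set.uIcc_of_le hr1.le] at ht
    exact (continuousAt_zpow₀ t _ (Or.inl (hr.trans_le ht.1).ne')).continuousWithinAt
  rw [logMoment, moment, ← intervalIntegral.integral_const_mul, ← Real.norm_eq_abs]
  refine intervalIntegral.norm_integral_le_of_norm_le hr1.le (Eventually.of_forall fun t ht => ?_)
    (hc.intervalIntegrable.const_mul _)
  have ht0 := hr.trans ht.1
  rw [norm_mul, Real.norm_of_nonneg (zpow_nonneg ht0.le _), mul_comm, Real.norm_eq_abs,
    abs_of_nonpos (Real.log_nonpos ht0.le ht.2)]
  exact mul_le_mul_of_nonneg_right (neg_le_neg (Real.log_le_log hr ht.1.le)) (zpow_nonneg ht0.le _)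

/-! Convergence of the Berezin transforms on shrinking annuli. -/

/-- The terms of the series for the kernel of `annulus r` on the diagonal, at modulus `s`. -/
def kernelTerm (r s : ℝ) (n : ℤ) : ℝ := s ^ (2 * n) / (2 * Real.pi * moment r n)

/-- The terms of the series for `⟨T K_z, K_z⟩`, with `T` the Toeplitz operator of `log |z|`. -/
def logKernelTerm (r s : ℝ) (n : ℤ) : ℝ := kernelTerm r s n * (logMoment r n / moment r n)

lemma zpow_neg_succ (s : ℝ) (k : ℕ) : s ^ (2 * (-((k : ℤ) + 1))) = ((s ^ 2) ^ (k + 1))⁻¹ := by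
  rw [show 2 * (-((k : ℤ) + 1)) = -(2 * ((k + 1 : ℕ) : ℤ)) by push_cast; ring, zpow_neg,
    zpow_two_mul_natCast]

lemma summable_sq_mul_geometric {x : ℝ} (h0 : 0 ≤ x) (h1 : x < 1) :
    Summable fun n : ℕ => 4 * ((n : ℝ) + 1) ^ 2 * x ^ n := by
  have hx : ‖x‖ < 1 := by rwa [Real.norm_of_nonneg h0]
  have h := fun k => summable_pow_mul_geometric_of_norm_lt_one (R := ℝ) k hx
  have h2 := (((h 2).add ((h 1).mul_left 2)).add (h 0)).mul_left 4
  refine h2.congr fun n => ?_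
  ring

/-! ### Bounds on the terms, summable and uniform in `r`. -/

section Bounds

variable {r s : ℝ}

lemma moment_natCast_pos (hr : 0 < r) (hr2 : r < 1 / 2) (n : ℕ) : 0 < moment r n :=
  lt_of_lt_of_le (by positivity) (le_moment_natCast hr hr2 n)

lemma inv_two_pi_mul_le {m c : ℝ} (hc : 0 < c) (h : (4 * c)⁻¹ ≤ m) :
    (2 * Real.pi * m)⁻¹ ≤ c := by
  have h0 : 0 < (4 * c)⁻¹ := by positivity
  have hm : 0 < m := h0.trans_le h
  have h1 : m⁻¹ ≤ 4 * c := by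
    rw [← inv_inv (4 * c)]
    exact inv_anti₀ h0 h
  rw [mul_inv]
  have h2 : (2 * Real.pi)⁻¹ ≤ 4⁻¹ := inv_anti₀ (by norm_num) (by linarith [Real.pi_gt_three])
  calc (2 * Real.pi)⁻¹ * m⁻¹ ≤ 4⁻¹ * (4 * c) := by gcongr
    _ = c := by ring

lemma abs_kernelTerm_natCast_le {b : ℝ} (hr : 0 < r) (hr2 : r < 1 / 2) (hs : 0 < s) (hb : s ≤ b)
    (n : ℕ) : |kernelTerm r s n| ≤ ((n : ℝ) + 1) * (b ^ 2) ^ n := by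
  have hm := moment_natCast_pos hr hr2 n
  rw [kernelTerm, zpow_two_mul_natCast, abs_of_nonneg (by positivity), div_eq_inv_mul]
  have := inv_two_pi_mul_le (by positivity) (le_moment_natCast hr hr2 n)
  gcongr

lemma abs_logKernelTerm_natCast_le {b : ℝ} (hr : 0 < r) (hr2 : r < 1 / 2) (hs : 0 < s)
    (hb : s ≤ b) (n : ℕ) : |logKernelTerm r s n| ≤ 4 * ((n : ℝ) + 1) ^ 2 * (b ^ 2) ^ n := by
  have hm := moment_natCast_pos hr hr2 n
  have h1 : |logMoment r n / moment r n| ≤ 4 * ((n : ℝ) + 1) := by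
    rw [abs_div, abs_of_pos hm, div_le_iff₀ hm]
    have h2 := mul_le_mul_of_nonneg_left (le_moment_natCast hr hr2 n)
      (by positivity : 0 ≤ 4 * ((n : ℝ) + 1))
    rw [mul_inv_cancel₀ (by positivity)] at h2
    exact (abs_logMoment_natCast_le hr (by linarith) n).trans h2
  rw [logKernelTerm, abs_mul]
  have hb0 : 0 < b := hs.trans_le hb
  calc _ ≤ ((n : ℝ) + 1) * (b ^ 2) ^ n * (4 * ((n : ℝ) + 1)) :=
        mul_le_mul (abs_kernelTerm_natCast_le hr hr2 hs hb n) h1 (abs_nonneg _) (by positivity)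
    _ = _ := by ring

lemma moment_neg_pos (hr : 0 < r) (hr2 : r < 1 / 2) (k : ℕ) : 0 < moment r (-((k : ℤ) + 1)) :=
  lt_of_lt_of_le (by positivity) (le_moment_neg hr hr2 k)

/-- Keeps `r²` rather than `r`: the spare factor `r ^ k` later absorbs the logarithm of the
eigenvalue. -/
lemma abs_kernelTerm_neg_le_sq {a : ℝ} (hr : 0 < r) (hr2 : r < 1 / 2) (ha : 0 < a) (hs : a ≤ s)
    (k : ℕ) :
    |kernelTerm r s (-((k : ℤ) + 1))| ≤ (a ^ 2)⁻¹ * (((k : ℝ) + 1) * (r ^ 2 / a ^ 2) ^ k) := by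
  have hm := moment_neg_pos hr hr2 k
  have hs0 := ha.trans_le hs
  rw [kernelTerm, zpow_neg_succ, abs_of_nonneg (by positivity), div_eq_inv_mul]
  have h1 := inv_two_pi_mul_le (c := ((k : ℝ) + 1) * r ^ (2 * k)) (by positivity)
    (m := moment r (-((k : ℤ) + 1))) (by rw [← mul_assoc]; exact le_moment_neg hr hr2 k)
  have h2 : ((s ^ 2) ^ (k + 1))⁻¹ ≤ ((a ^ 2) ^ (k + 1))⁻¹ := by gcongr
  calc _ ≤ ((k : ℝ) + 1) * r ^ (2 * k) * ((a ^ 2) ^ (k + 1))⁻¹ := by gcongr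
    _ = _ := by rw [pow_mul, div_pow, pow_succ (a ^ 2)]; field_simp

lemma abs_kernelTerm_neg_le {a : ℝ} (hr : 0 < r) (hr2 : r < 1 / 2) (ha : 0 < a) (hs : a ≤ s)
    (k : ℕ) :
    |kernelTerm r s (-((k : ℤ) + 1))| ≤ (a ^ 2)⁻¹ * (((k : ℝ) + 1) * (r / a ^ 2) ^ k) := by
  refine (abs_kernelTerm_neg_le_sq hr hr2 ha hs k).trans ?_
  have : r ^ 2 ≤ r := by nlinarith
  gcongr

/-- The weight carries `1 / (-log r)` and the eigenvalue is `log r / 2`, so the dependence on `r`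
cancels. This term causes the discontinuity of the Berezin transform. -/
lemma logKernelTerm_neg_one (hr : 0 < r) (hr2 : r < 1 / 2) :
    logKernelTerm r s (-1) = -(1 / (4 * Real.pi * s ^ 2)) := by
  have hl : Real.log r ≠ 0 := (Real.log_neg hr (by linarith)).ne
  rw [logKernelTerm, kernelTerm, moment_neg_one hr, logMoment_neg_one hr (by linarith),
    show (2 * (-1) : ℤ) = -((2 : ℕ) : ℤ) by norm_num, zpow_neg, zpow_natCast]
  by_cases hs : s = 0
  · simp [hs]
  field_simp
  norm_num

lemma abs_logKernelTerm_neg_le {a : ℝ} (hr : 0 < r) (hr2 : r < 1 / 2) (ha : 0 < a) (hs : a ≤ s)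
    (k : ℕ) :
    |logKernelTerm r s (-((k : ℤ) + 1))| ≤ (a ^ 2)⁻¹ * (((k : ℝ) + 1) * (r / a ^ 2) ^ k) := by
  have hs0 := ha.trans_le hs
  rcases Nat.eq_zero_or_pos k with rfl | hk
  · simp only [Nat.cast_zero, zero_add, pow_zero, mul_one]
    rw [logKernelTerm_neg_one hr hr2, abs_neg, abs_of_nonneg (by positivity), one_div]
    refine inv_anti₀ (by positivity) ?_
    have : a ^ 2 ≤ s ^ 2 := by gcongr
    nlinarith [Real.pi_gt_three, sq_nonneg s]
  · have hm := moment_neg_pos hr hr2 k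
    have h1 : |logMoment r (-((k : ℤ) + 1)) / moment r (-((k : ℤ) + 1))| ≤ -Real.log r := by
      rw [abs_div, abs_of_pos hm, div_le_iff₀ hm]
      exact abs_logMoment_le hr (by linarith) _
    have h2 : r * -Real.log r ≤ 1 := by
      have := (Real.abs_log_mul_self_lt r hr (by linarith)).le
      linarith [neg_abs_le (Real.log r * r)]
    -- One factor `r` tames the logarithm; this needs `k ≥ 1`, hence the separate exact value at `k
    -- = 0`.
    have h3 : (r ^ 2) ^ k * -Real.log r ≤ r ^ k := by
      obtain ⟨m, rfl⟩ : ∃ m, k = m + 1 := ⟨k - 1, by omega⟩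
      have hp : r ^ m ≤ 1 := pow_le_one₀ hr.le (by linarith)
      have hp0 : 0 ≤ r ^ m := by positivity
      calc (r ^ 2) ^ (m + 1) * -Real.log r = r ^ (m + 1) * (r ^ m * (r * -Real.log r)) := by ring
        _ ≤ r ^ (m + 1) * 1 := by gcongr; nlinarith
        _ = _ := mul_one _
    rw [logKernelTerm, abs_mul]
    calc _ ≤ (a ^ 2)⁻¹ * (((k : ℝ) + 1) * (r ^ 2 / a ^ 2) ^ k) * -Real.log r :=
          mul_le_mul (abs_kernelTerm_neg_le_sq hr hr2 ha hs k) h1 (abs_nonneg _) (by positivity)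
      _ = (a ^ 2)⁻¹ * (((k : ℝ) + 1) * ((r ^ 2) ^ k * -Real.log r / (a ^ 2) ^ k)) := by
          rw [div_pow]; ring
      _ ≤ (a ^ 2)⁻¹ * (((k : ℝ) + 1) * (r ^ k / (a ^ 2) ^ k)) := by gcongr
      _ = _ := by rw [div_pow]

end Bounds

/-- A version of Tannery's theorem for the two-sided series at hand. -/
lemma tendsto_tsum_int {g : ℝ → ℝ → ℤ → ℝ} {s₀ : ℝ} (h0 : 0 < s₀) (h1 : s₀ < 1)
    (hpos : ∀ {r s b : ℝ}, 0 < r → r < 1 / 2 → 0 < s → s ≤ b → ∀ n : ℕ,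
      |g r s n| ≤ 4 * ((n : ℝ) + 1) ^ 2 * (b ^ 2) ^ n)
    (hneg : ∀ {r s a : ℝ}, 0 < r → r < 1 / 2 → 0 < a → a ≤ s → ∀ k : ℕ,
      |g r s (-((k : ℤ) + 1))| ≤ (a ^ 2)⁻¹ * (((k : ℝ) + 1) * (r / a ^ 2) ^ k))
    {l : ℕ → ℝ} {S l' : ℝ} (hS : HasSum l S)
    (hl : ∀ n : ℕ, Tendsto (fun q : ℝ × ℝ => g q.1 q.2 n) (𝓝[>] 0 ×ˢ 𝓝 s₀) (𝓝 (l n)))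
    (hl' : Tendsto (fun q : ℝ × ℝ => g q.1 q.2 (-1)) (𝓝[>] 0 ×ˢ 𝓝 s₀) (𝓝 l')) :
    Tendsto (fun q : ℝ × ℝ => ∑' n, g q.1 q.2 n) (𝓝[>] 0 ×ˢ 𝓝 s₀) (𝓝 (S + l')) := by
  -- The window `a ≤ s ≤ b` around `s₀` makes the majorants independent of `s`; small `r` makes the
  -- negative ratio `r / a²` at most `1 / 2`.
  obtain ⟨b, hb0, hb1⟩ := exists_between h1
  obtain ⟨a, ha, ha0⟩ := exists_between h0
  have hev : ∀ᶠ q : ℝ × ℝ in 𝓝[>] 0 ×ˢ 𝓝 s₀,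
      (0 < q.1 ∧ q.1 < 1 / 2 ∧ q.1 / a ^ 2 ≤ 1 / 2) ∧ (a ≤ q.2 ∧ q.2 ≤ b) := by
    have e1 : ∀ᶠ r : ℝ in 𝓝[>] 0, 0 < r ∧ r < 1 / 2 ∧ r / a ^ 2 ≤ 1 / 2 := by
      have h2 : (0 : ℝ) < min (1 / 2) (a ^ 2 / 2) := by positivity
      filter_upwards [Ioo_mem_nhdsGT h2] with r hr
      refine ⟨hr.1, hr.2.trans_le (min_le_left _ _), ?_⟩
      rw [div_le_iff₀ (by positivity)]
      linarith [hr.2.le.trans (min_le_right _ _)]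
    have e2 : ∀ᶠ s in 𝓝 s₀, a ≤ s ∧ s ≤ b := Icc_mem_nhds ha0 hb0
    exact e1.prod_mk e2
  have hbs : Summable fun n : ℕ => 4 * ((n : ℝ) + 1) ^ 2 * (b ^ 2) ^ n :=
    summable_sq_mul_geometric (sq_nonneg b) (by nlinarith)
  have has : Summable fun k : ℕ => (a ^ 2)⁻¹ * (((k : ℝ) + 1) * (1 / 2) ^ k) :=
    (hasSum_succ_mul_geometric (by norm_num) (by norm_num)).summable.mul_left _
  have hevpos : ∀ᶠ q : ℝ × ℝ in 𝓝[>] 0 ×ˢ 𝓝 s₀, ∀ n : ℕ,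
      ‖g q.1 q.2 n‖ ≤ 4 * ((n : ℝ) + 1) ^ 2 * (b ^ 2) ^ n := by
    filter_upwards [hev] with q ⟨⟨hr, hr2, _⟩, hsa, hsb⟩ n
    exact hpos hr hr2 (ha.trans_le hsa) hsb n
  have hevneg : ∀ᶠ q : ℝ × ℝ in 𝓝[>] 0 ×ˢ 𝓝 s₀, ∀ k : ℕ,
      ‖g q.1 q.2 (-((k : ℤ) + 1))‖ ≤ (a ^ 2)⁻¹ * (((k : ℝ) + 1) * (1 / 2) ^ k) := by
    filter_upwards [hev] with q ⟨⟨hr, hr2, hra⟩, hsa, hsb⟩ k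
    refine (hneg hr hr2 ha hsa k).trans ?_
    gcongr
  have t1 := tendsto_tsum_of_dominated_convergence hbs hl hevpos
  -- Among the negative indices `-(k + 1)` only `k = 0` has a possibly nonzero limit.
  have t2 := tendsto_tsum_of_dominated_convergence (g := fun k : ℕ => if k = 0 then l' else 0) has
    (fun k => ?_) hevneg
  · rw [hS.tsum_eq] at t1
    rw [tsum_ite_eq] at t2
    refine (t1.add t2).congr' ?_
    filter_upwards [hevpos, hevneg] with q h2 h3
    exact (tsum_of_nat_of_neg_add_one (hbs.of_norm_bounded h2) (has.of_norm_bounded h3)).symm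
  · rcases Nat.eq_zero_or_pos k with rfl | hk
    · simpa using hl'
    · rw [if_neg hk.ne']
      have hfst : Tendsto (fun q : ℝ × ℝ => q.1) (𝓝[>] 0 ×ˢ 𝓝 s₀) (𝓝 0) :=
        tendsto_fst.mono_right nhdsWithin_le_nhds
      have hlim : Tendsto (fun q : ℝ × ℝ => (a ^ 2)⁻¹ * (((k : ℝ) + 1) * (q.1 / a ^ 2) ^ k))
          (𝓝[>] 0 ×ˢ 𝓝 s₀) (𝓝 0) := by
        have := (((hfst.div_const (a ^ 2)).pow k).const_mul ((k : ℝ) + 1)).const_mul (a ^ 2)⁻¹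
        simpa [hk.ne'] using this
      refine squeeze_zero_norm' ?_ hlim
      filter_upwards [hev] with q ⟨⟨hr, hr2, _⟩, hsa, _⟩
      exact hneg hr hr2 ha hsa k

/-! ### Termwise limits and the limit of the quotient. -/

section Limits

variable {s₀ : ℝ}

lemma tendsto_kernelTerm_natCast (n : ℕ) :
    Tendsto (fun q : ℝ × ℝ => kernelTerm q.1 q.2 n) (𝓝[>] 0 ×ˢ 𝓝 s₀)
      (𝓝 (kernelTerm 0 s₀ n)) := by
  simp only [kernelTerm, zpow_two_mul_natCast]
  refine ((tendsto_snd.pow 2).pow n).div (((tendsto_moment n).comp tendsto_fst).const_mul _) ?_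
  rw [moment_zero]
  positivity

lemma tendsto_logKernelTerm_natCast (n : ℕ) :
    Tendsto (fun q : ℝ × ℝ => logKernelTerm q.1 q.2 n) (𝓝[>] 0 ×ˢ 𝓝 s₀)
      (𝓝 (logKernelTerm 0 s₀ n)) := by
  refine (tendsto_kernelTerm_natCast n).mul (((tendsto_logMoment n).comp tendsto_fst).div
    ((tendsto_moment n).comp tendsto_fst) ?_)
  rw [moment_zero]
  positivity

lemma tendsto_kernelTerm_neg_one (h0 : 0 < s₀) :
    Tendsto (fun q : ℝ × ℝ => kernelTerm q.1 q.2 (-1)) (𝓝[>] 0 ×ˢ 𝓝 s₀) (𝓝 0) := by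
  have h1 : Tendsto (fun q : ℝ × ℝ => moment q.1 (-1)) (𝓝[>] 0 ×ˢ 𝓝 s₀) atTop := by
    have h : Tendsto (fun r => moment r (-1)) (𝓝[>] 0) atTop := by
      refine (tendsto_neg_atBot_atTop.comp Real.tendsto_log_nhdsGT_zero).congr' ?_
      filter_upwards [self_mem_nhdsWithin] with r hr
      exact (moment_neg_one hr).symm
    exact h.comp tendsto_fst
  have h2 : Tendsto (fun q : ℝ × ℝ => q.2 ^ (2 * (-1) : ℤ)) (𝓝[>] 0 ×ˢ 𝓝 s₀)
      (𝓝 (s₀ ^ (2 * (-1) : ℤ))) := tendsto_snd.zpow₀ _ (Or.inl h0.ne')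
  exact h2.div_atTop (h1.const_mul_atTop Real.two_pi_pos)

lemma tendsto_logKernelTerm_neg_one (h0 : 0 < s₀) :
    Tendsto (fun q : ℝ × ℝ => logKernelTerm q.1 q.2 (-1)) (𝓝[>] 0 ×ˢ 𝓝 s₀)
      (𝓝 (-(1 / (4 * Real.pi * s₀ ^ 2)))) := by
  have h2 : Tendsto (fun q : ℝ × ℝ => -(1 / (4 * Real.pi * q.2 ^ 2))) (𝓝[>] 0 ×ˢ 𝓝 s₀)
      (𝓝 (-(1 / (4 * Real.pi * s₀ ^ 2)))) :=
    (tendsto_const_nhds.div ((tendsto_snd.pow 2).const_mul _) (by positivity)).neg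
  refine h2.congr' ?_
  filter_upwards [tendsto_fst.eventually
    (Ioo_mem_nhdsGT (show (0 : ℝ) < 1 / 2 by norm_num))] with q hq
  exact (logKernelTerm_neg_one hq.1 hq.2).symm

lemma tendsto_berezin_quotient (h0 : 0 < s₀) (h1 : s₀ < 1) :
    Tendsto (fun q : ℝ × ℝ => (∑' n, logKernelTerm q.1 q.2 n) / ∑' n, kernelTerm q.1 q.2 n)
      (𝓝[>] 0 ×ˢ 𝓝 s₀) (𝓝 (s₀ ^ 2 / 4 - 1 / (4 * s₀ ^ 2))) := by
  have hs : 0 < 1 - s₀ ^ 2 := by nlinarith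
  have t1 := tendsto_tsum_int h0 h1 abs_logKernelTerm_natCast_le abs_logKernelTerm_neg_le
    (hasSum_logKernel_zero h0.le h1) tendsto_logKernelTerm_natCast
    (tendsto_logKernelTerm_neg_one h0)
  have t2 := tendsto_tsum_int h0 h1 (fun {r s b} hr hr2 hs hb n =>
      (abs_kernelTerm_natCast_le hr hr2 hs hb n).trans ?_) abs_kernelTerm_neg_le
    (hasSum_kernel_zero h0.le h1) tendsto_kernelTerm_natCast (tendsto_kernelTerm_neg_one h0)
  · have hne : 1 / (Real.pi * (1 - s₀ ^ 2) ^ 2) + 0 ≠ 0 := by positivity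
    have heq : s₀ ^ 2 / 4 - 1 / (4 * s₀ ^ 2)
        = (-(1 / (2 * Real.pi * (1 - s₀ ^ 2))) + -(1 / (4 * Real.pi * s₀ ^ 2)))
          / (1 / (Real.pi * (1 - s₀ ^ 2) ^ 2) + 0) := by
      rw [add_zero]
      field_simp
      ring
    rw [heq]
    exact t1.div t2 hne
  · have : (n : ℝ) + 1 ≤ 4 * ((n : ℝ) + 1) ^ 2 := by nlinarith [n.cast_nonneg (α := ℝ)]
    gcongr

end Limits

/-! ### From moduli to points, and local uniformity. -/

lemma tendsto_berezin_annulus {z : ℂ} (hz : z ∈ puncturedDisc) :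
    Tendsto (fun q : ℝ × ℂ => berezin (annulus q.1) logNorm q.2) (𝓝[>] 0 ×ˢ 𝓝 z)
      (𝓝 ((‖z‖ ^ 2 / 4 - 1 / (4 * ‖z‖ ^ 2) : ℝ) : ℂ)) := by
  rw [← annulus_zero] at hz
  have hmap : Tendsto (fun q : ℝ × ℂ => (q.1, ‖q.2‖)) (𝓝[>] 0 ×ˢ 𝓝 z) (𝓝[>] 0 ×ˢ 𝓝 ‖z‖) :=
    tendsto_id.prodMap (continuous_norm.tendsto z)
  refine ((Complex.continuous_ofReal.tendsto _).comp
    ((tendsto_berezin_quotient hz.1 hz.2).comp hmap)).congr' ?_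
  -- For `r < a` the nearby points lie in the annulus, where `berezin` is not the default `0`.
  obtain ⟨a, ha, haz⟩ := exists_between hz.1
  have hev : ∀ᶠ q : ℝ × ℂ in 𝓝[>] 0 ×ˢ 𝓝 z, (0 < q.1 ∧ q.1 < a) ∧ (a < ‖q.2‖ ∧ ‖q.2‖ < 1) := by
    have e1 : ∀ᶠ r : ℝ in 𝓝[>] 0, 0 < r ∧ r < a := Ioo_mem_nhdsGT ha
    have e2 : ∀ᶠ w in 𝓝 z, a < ‖w‖ ∧ ‖w‖ < 1 :=
      (continuous_norm.tendsto z).eventually (Ioo_mem_nhds haz hz.2)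
    exact e1.prod_mk e2
  filter_upwards [hev] with q ⟨⟨hr, hra⟩, hqa, hq1⟩
  have hmem : q.2 ∈ annulus q.1 := ⟨hra.trans hqa, hq1⟩
  exact ((isMonomialIndex_int hr (hra.trans (hqa.trans hq1))).berezin_eq
    (isBoundedSymbol_annulus hr) hmem).symm

/-- Convergence jointly in `r` and in the point, together with continuity of the limit, is locally
uniform convergence. -/
lemma tendstoLocallyUniformlyOn_berezin :
    TendstoLocallyUniformlyOn (fun (r : ℝ) (z : ℂ) => berezin (annulus r) logNorm z)
      (fun z : ℂ => ((‖z‖ ^ 2 / 4 - 1 / (4 * ‖z‖ ^ 2) : ℝ) : ℂ)) (𝓝[>] (0 : ℝ))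
      (puncturedDisc : Set ℂ) := by
  rw [tendstoLocallyUniformlyOn_iff_filter]
  intro z hz
  rw [puncturedDisc.isOpen.nhdsWithin_eq hz, tendstoUniformlyOnFilter_iff_tendsto]
  have hz0 : ‖z‖ ≠ 0 := norm_ne_zero_iff.mpr hz.1
  have hc : Tendsto (fun z : ℂ => ((‖z‖ ^ 2 / 4 - 1 / (4 * ‖z‖ ^ 2) : ℝ) : ℂ)) (𝓝 z)
      (𝓝 ((‖z‖ ^ 2 / 4 - 1 / (4 * ‖z‖ ^ 2) : ℝ) : ℂ)) := by
    have hn := (continuous_norm.tendsto z).pow 2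
    exact (Complex.continuous_ofReal.tendsto _).comp ((hn.div_const 4).sub
      (tendsto_const_nhds.div (hn.const_mul 4) (by positivity)))
  exact ((hc.comp tendsto_snd).prodMk_nhds (tendsto_berezin_annulus hz)).mono_right
    (nhds_le_uniformity _)

end Bergman

end

theorem mainTheorem6 :
    -- the Toeplitz operators whose Berezin transforms are taken are defined and bounded
    (∀ r ∈ Set.Ioo (0 : ℝ) 1, Bergman.IsBoundedSymbol (Bergman.annulus r) Bergman.logNorm) ∧
    Bergman.IsBoundedSymbol Bergman.puncturedDisc Bergman.logNorm ∧
    -- convergence on compact subsets of the punctured disc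
    (∀ K : Set ℂ, IsCompact K → K ⊆ (Bergman.puncturedDisc : Set ℂ) →
      TendstoUniformlyOn (fun (r : ℝ) (z : ℂ) => Bergman.berezin (Bergman.annulus r) Bergman.logNorm z)
        (fun z : ℂ => ((‖z‖ ^ 2 / 4 - 1 / (4 * ‖z‖ ^ 2) : ℝ) : ℂ)) (𝓝[>] (0 : ℝ)) K) ∧
    -- the Berezin transform on the punctured disc is another function
    (∀ z ∈ Bergman.puncturedDisc,
      Bergman.berezin Bergman.puncturedDisc Bergman.logNorm z = (((‖z‖ ^ 2 - 1) / 2 : ℝ) : ℂ) ∧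
      ‖z‖ ^ 2 / 4 - 1 / (4 * ‖z‖ ^ 2) ≠ (‖z‖ ^ 2 - 1) / 2) := by
  refine ⟨fun r hr => Bergman.isBoundedSymbol_annulus hr.1, ?_, fun K hK hKD => ?_, fun z hz => ?_⟩
  · rw [← Bergman.annulus_zero]
    exact Bergman.isBoundedSymbol_annulus_zero
  · exact (tendstoLocallyUniformlyOn_iff_forall_isCompact Bergman.puncturedDisc.isOpen).mp
      Bergman.tendstoLocallyUniformlyOn_berezin K hKD hK
  · refine ⟨Bergman.berezin_puncturedDisc hz, fun h => ?_⟩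
    have hz0 : 0 < ‖z‖ := norm_pos_iff.mpr hz.1
    have hz1 : ‖z‖ < 1 := hz.2
    field_simp at h
    -- The two functions differ by `(1 - |z|²)² / (4 |z|²)`, so equality would force `|z| = 1`.
    have h2 : (1 - ‖z‖ ^ 2) ^ 2 = 0 := by linarith
    have h3 : 1 - ‖z‖ ^ 2 = 0 := pow_eq_zero_iff two_ne_zero |>.mp h2
    nlinarith
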